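/- Let $2\le d<n$ and $t_1<\dots<t_n$ be reals. Let $C(n,d)\subset\mathbb R^d$ be the convex hull of the points $v_i=(t_i,t_i^2,\dots,t_i^d)$, $1\le i\le n$, and let $\pi:C(n,d)\to C(n,1)=[t_1,t_n]$ be the projection to the first coordinate. A cellular string for $\pi$ is a sequence $\sigma=(F_1,\dots,F_k)$, $k\ge1$, of nonempty faces of $C(n,d)$ such that $v_1\in F_1$, $v_n\in F_k$ and $\max\pi(F_i)=\min\pi(F_{i+1})$ for $1\le i<k$. It describes the subdivision of $C(n,1)$ into the intervals $\pi(F_i)$ and their end points, labelled by the family consisting of the faces $F_i$ and of their initial and terminal vertices (the vertices of $F_i$ at which $\pi$ is minimal, respectively maximal). A linear functional $f$ on $\mathbb R^d$ induces the family $\{F_q : q\in C(n,1)\}$, where $F_q$ is the smallest face of $C(n,d)$ that contains the face of the fiber $\pi^{-1}(q)$ on which $f$ is minimized; $\sigma$ is called $\pi$-coherent if its family is the one induced by some $f$. Define $\lambda_\sigma=(\lambda_2,\dots,\lambda_{n-1})\in\{0,+,-\}^{n-2}$ by: $\lambda_i=+$ if $v_i$ lies in no face of $\sigma$; $\lambda_i=-$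 if $v_i$ is the initial or terminal vertex of some face of $\sigma$; $\lambda_i=0$ otherwise. For a sign vector $\lambda$, let $m(\lambda)$ be the number of zero entries, plus the number of pairs $i<j$ such that $\lambda_i,\lambda_j$ are nonzero of opposite sign and are separated by an even number (possibly none) of entries, all zero, plus the number of pairs $i<j$ such that $\lambda_i,\lambda_j$ are nonzero of the same sign and are separated by an odd number of entries, all zero. Then every cellular string $\sigma$ for $\pi$ none of whose faces is the whole polytope $C(n,d)$ is $\pi$-coherent if and only if $m(\lambda_\sigma)\le d-2$. Moreover, whether a cellular string is $\pi$-coherent does not depend on the parameters: if $\sigma=(F_1,\dots,F_k)$ is a cellular string for the parameters $t_1<\dots<t_n$ and $t'_1<\dots<t'_n$ are other parameters, with points $v'_i$, then the sequence $\sigma'$ of the sets $F'_r=\operatorname{conv}\{v'_i : v_i\in F_r\}$ is a cellular string for the parameters $t'$, and $\sigma$ is $\pi$-coherent if and only if $\sigma'$ is. -/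

import Mathlib

namespace CyclicString

/-! ### Polytopes, faces, and subdivisions induced by a functional -/

section General

variable {E E' : Type*} [AddCommGroup E] [Module ℝ E] [TopologicalSpace E]
  [AddCommGroup E'] [Module ℝ E']

/-- Nonempty faces of a polytope `P` (with `P` itself allowed): the sets of points of `P` at which
some linear functional attains its maximum over `P`. -/
def IsFace (P F : Set E) : Prop :=
  F.Nonempty ∧ IsExposed ℝ P F

/-- The face of the fiber `P ∩ π⁻¹(q)` on which the functional `f` is minimized. -/
def fiberMin (π : E →ₗ[ℝ] E') (P : Set E) (f : E →ₗ[ℝ] ℝ) (q : E') : Set E :=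
  {x | x ∈ P ∧ π x = q ∧ ∀ y ∈ P, π y = q → f x ≤ f y}

/-- The family `{F_q : q ∈ π(P)}` of faces of `P` induced by the functional `f`, where `F_q` is the
smallest face of `P` containing the face of the fiber over `q` on which `f` is minimized (that is,
the face whose relative interior contains the relative interior of that face of the fiber). -/
def inducedFamily (π : E →ₗ[ℝ] E') (P : Set E) (f : E →ₗ[ℝ] ℝ) : Set (Set E) :=
  {F | ∃ q ∈ π '' P, IsLeast {G | IsFace P G ∧ fiberMin π P f q ⊆ G} F}

/-- The face of `F` on which `π` is minimal. -/
def initialFace (π : E →ₗ[ℝ] ℝ) (F : Set E) : Set E :=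
  {x | x ∈ F ∧ ∀ y ∈ F, π x ≤ π y}

/-- The face of `F` on which `π` is maximal. -/
def terminalFace (π : E →ₗ[ℝ] ℝ) (F : Set E) : Set E :=
  {x | x ∈ F ∧ ∀ y ∈ F, π y ≤ π x}

/-- The family of faces of `P` labelling the subdivision of the segment `π(P)` given by a sequence
`σ` of faces: the members of `σ` (lying over the cells `π(F)`) and their initial and terminal faces
(lying over the end points of these cells). -/
def stringFamily (π : E →ₗ[ℝ] ℝ) (σ : List (Set E)) : Set (Set E) :=
  {G | ∃ F ∈ σ, G = F ∨ G = initialFace π F ∨ G = terminalFace π F}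

end General

/-! ### Cyclic polytopes and their cellular strings -/

/-- The point `(s, s², …, s^d)` of the moment curve. -/
def moment (d : ℕ) (s : ℝ) : Fin d → ℝ :=
  fun k => s ^ ((k : ℕ) + 1)

/-- The cyclic polytope `C(n,d)` with parameters `t_1 < ⋯ < t_n`. -/
def cyclicPolytope (d : ℕ) {n : ℕ} (t : Fin n → ℝ) : Set (Fin d → ℝ) :=
  convexHull ℝ (Set.range fun i => moment d (t i))

/-- The projection `π : C(n,d) → C(n,1)`, `x ↦ x_1`, with `ℝ¹` identified with `ℝ`. -/
def firstCoord (d : ℕ) [NeZero d] : (Fin d → ℝ) →ₗ[ℝ] ℝ :=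
  LinearMap.proj 0

/-- Cellular strings `σ = (F_1, …, F_k)`, `k ≥ 1`, on `C(n,d)` with respect to `π`: sequences of
faces with `v_1 ∈ F_1`, `v_n ∈ F_k`, and `max π(F_i) = min π(F_{i+1})`. -/
structure IsCellularString {n d : ℕ} [NeZero n] [NeZero d] (t : Fin n → ℝ)
    (σ : List (Set (Fin d → ℝ))) : Prop where
  isFace : ∀ F ∈ σ, IsFace (cyclicPolytope d t) F
  first_mem : ∃ F ∈ σ.head?, moment d (t 0) ∈ F
  last_mem : ∃ F ∈ σ.getLast?,
    moment d (t ⟨n - 1, Nat.sub_lt (NeZero.pos n) Nat.one_pos⟩) ∈ F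
  chain : σ.IsChain fun F G =>
    ∃ c : ℝ, IsGreatest (firstCoord d '' F) c ∧ IsLeast (firstCoord d '' G) c

/-- A string `σ` is `π`-coherent if the subdivision it describes is the one induced by some linear
functional `f` on `ℝ^d`. -/
def IsCoherent {n d : ℕ} [NeZero d] (t : Fin n → ℝ) (σ : List (Set (Fin d → ℝ))) : Prop :=
  ∃ f : (Fin d → ℝ) →ₗ[ℝ] ℝ,
    inducedFamily (firstCoord d) (cyclicPolytope d t) f = stringFamily (firstCoord d) σ

open Classical in
/-- The sign vector `λ_σ = (λ_2, …, λ_{n-1})`. The entry at position `i : Fin (n - 2)` belongs to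
the vertex `v` whose zero-based index is `i + 1`: it is `+` if `v` does not appear in `σ`, `-` if
`v` is the initial or terminal vertex of some face of `σ`, and `0` otherwise. -/
noncomputable def signVector {n d : ℕ} [NeZero d] (t : Fin n → ℝ) (σ : List (Set (Fin d → ℝ)))
    (i : Fin (n - 2)) : SignType :=
  let v : Fin d → ℝ := moment d (t ⟨(i : ℕ) + 1, by omega⟩)
  if ∀ F ∈ σ, v ∉ F then 1
  else if ∃ F ∈ σ, v ∈ initialFace (firstCoord d) F ∨ v ∈ terminalFace (firstCoord d) F then -1
  else 0

/-- The face of the cyclic polytope with parameters `t'` that corresponds to the face `F` of the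
one with parameters `t`: it has the vertices with the same indices. -/
def transport {n d : ℕ} (t t' : Fin n → ℝ) (F : Set (Fin d → ℝ)) : Set (Fin d → ℝ) :=
  convexHull ℝ ((fun i => moment d (t' i)) '' {i | moment d (t i) ∈ F})

/-! ### The statistic `m` on sign vectors -/

/-- Even gaps: pairs `i < j` with nonzero entries of opposite sign, separated by an even number of
entries, all zero. -/
def evenGaps {N : ℕ} (l : Fin N → SignType) : Finset (Fin N × Fin N) :=
  Finset.univ.filter fun p => p.1 < p.2 ∧ l p.1 ≠ 0 ∧ l p.2 ≠ 0 ∧ l p.1 ≠ l p.2 ∧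
    (∀ r, p.1 < r → r < p.2 → l r = 0) ∧ Even ((p.2 : ℕ) - (p.1 : ℕ) - 1)

/-- Odd gaps: pairs `i < j` with nonzero entries of the same sign, separated by an odd number of
entries, all zero. -/
def oddGaps {N : ℕ} (l : Fin N → SignType) : Finset (Fin N × Fin N) :=
  Finset.univ.filter fun p => p.1 < p.2 ∧ l p.1 ≠ 0 ∧ l p.2 ≠ 0 ∧ l p.1 = l p.2 ∧
    (∀ r, p.1 < r → r < p.2 → l r = 0) ∧ Odd ((p.2 : ℕ) - (p.1 : ℕ) - 1)

/-- `m(l)`: the number of even gaps plus the number of odd gaps plus the number of zeros. -/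
def gapNumber {N : ℕ} (l : Fin N → SignType) : ℕ :=
  (evenGaps l).card + (oddGaps l).card + (Finset.univ.filter fun i => l i = 0).card

end CyclicString

/-!
For a functional `f`, let `p s = f (s, s², …, s^d)`, a polynomial of degree at most `d`. The
family induced by `f` labels the lower hull of the points `(t_i, p(t_i))`. Hence a cellular string
`σ` is coherent exactly when some `p` satisfies the following: for each interior index `i`, with
adjacent break points `a_i < t_i < c_i` of the subdivision, the second difference of `p` at `t_i`
with respect to `a_i` and `c_i` has the sign `λ_i` (`isCoherent_iff_supports`,
`forall_supports_iff`). It is negative at the break points, where the lower hull is strictly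
convex; at the other vertices it says whether the vertex lies on or above the edge below it.

Up to a sign, these second differences are the integrals of `p''` against hat functions
(`integral_hat_mul`). A linear relation with coefficients `y` between them, valid for all `p`,
means that the spline with the coefficients `y` is orthogonal to all polynomials of degree at most
`d - 2`. Such a spline changes its sign at least `d - 1` times, since otherwise some polynomial of
degree at most `d - 2` has its signs (`exists_polynomial_mul_nonneg`); and a spline changes its
sign at most as often as its coefficients (`BreakSystem.hasAlternation_of_spline`). So every
relation alternates `d` times, as if the second differences were the values at `n - 2` points of
polynomials of degree at most `d - 2`.

For a family of linear functionals with this property, elementary duality determines all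
realizable sign vectors (`exists_sign_eq_iff`): they are `0` and those that do not alternate `d`
times however their zeros are replaced by signs. The largest number of sign changes obtained by
replacing zeros is the statistic `m` (`gapNumber_le_iff`). This is the criterion, since `λ = 0`
only if the whole polytope is a face of the string (`signVector_ne_zero`).

The same duality, applied to the values of polynomials of degree at most `d` at the `t_i`, shows
that the vertex sets of faces do not depend on the parameters (`isFace_transport`). Corresponding
strings then have the same sign vector, and the criterion `isCoherent_iff` does not involve the
parameters.
-/

namespace CyclicString

/-! ### Sign alternations and realizable sign vectors -/

/-- The function `y` changes its sign strictly along some increasing sequence of `k` arguments.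
For `k ≤ 1` this says nothing about signs. -/
def HasAlternation {α : Type*} [LT α] (y : α → ℝ) (k : ℕ) : Prop :=
  ∃ l : List α, l.length = k ∧ l.IsChain fun a b => a < b ∧ y a * y b < 0

/-- The zeros of `μ` can be replaced by signs in such a way that the result alternates along some
increasing sequence of `k` indices. The sequence is recorded as a list of pairs (index, sign). -/
def HasWeakAlternation {α : Type*} [LT α] (μ : α → SignType) (k : ℕ) : Prop :=
  ∃ l : List (α × SignType), l.length = k ∧ (l.IsChain fun a b => a.1 < b.1 ∧ b.2 = -a.2) ∧
    ∀ a ∈ l, a.2 ≠ 0 ∧ (μ a.1 = 0 ∨ μ a.1 = a.2)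

theorem ne_zero_of_mem_alternation {α : Type*} [LT α] {y : α → ℝ} :
    ∀ {l : List α}, 2 ≤ l.length → (l.IsChain fun a b => a < b ∧ y a * y b < 0) →
      ∀ a ∈ l, y a ≠ 0
  | [], h, _ => by simp at h
  | [a], h, _ => by simp at h
  | a :: b :: l, _, hc => by
    have hab := (List.isChain_cons_cons.1 hc).1.2
    refine hc.induction (fun a => y a ≠ 0) _ ?_ ?_
    · rintro x z ⟨-, h⟩ - hz
      simp [hz] at h
    · intro _ h
      simp only [List.head_cons] at h
      simp [h] at hab

theorem pairwise_lt_of_alternation {α : Type*} [Preorder α] {y : α → ℝ} {l : List α}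
    (h : l.IsChain fun a b => a < b ∧ y a * y b < 0) : l.Pairwise (· < ·) :=
  List.isChain_iff_pairwise.1 (h.imp fun _ _ h => h.1)

section Realizable

variable {ι V : Type*} [Fintype ι] [LinearOrder ι] [AddCommGroup V] [Module ℝ V]

/-- If every nontrivial linear relation between the coordinates of `D` alternates `e + 2` times,
then any `e + 2` coordinates are related by coefficients that are all nonzero and alternate. -/
theorem exists_alternating_relation [FiniteDimensional ℝ V]
    (D : V →ₗ[ℝ] (ι → ℝ)) {e : ℕ}
    (hV : Module.finrank ℝ V ≤ e + 1)
    (h : ∀ y : ι → ℝ, y ≠ 0 → (∀ v, ∑ i, y i * D v i = 0) → HasAlternation y (e + 2))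
    (T : Finset ι) (hT : T.card = e + 2) :
    ∃ y : ι → ℝ, (∀ v, ∑ i, y i * D v i = 0) ∧ (∀ i, y i ≠ 0 ↔ i ∈ T) ∧
      ∃ l : List ι, (∀ i, i ∈ l ↔ i ∈ T) ∧ l.IsChain fun a b => a < b ∧ y a * y b < 0 := by
  have hdep : ¬ LinearIndependent ℝ
      (fun i : T => (LinearMap.proj (i : ι) ∘ₗ D : Module.Dual ℝ V)) := by
    intro hli
    have := hli.fintype_card_le_finrank
    rw [Subspace.dual_finrank_eq, Fintype.card_coe] at this
    omega
  obtain ⟨g, hg, i0, hi0⟩ := Fintype.not_linearIndependent_iff.1 hdep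
  set y : ι → ℝ := fun i => if hi : i ∈ T then g ⟨i, hi⟩ else 0 with hy
  have hyT : ∀ i, i ∉ T → y i = 0 := fun i hi => by simp [hy, hi]
  have hyg : ∀ i : T, y i = g i := fun i => by simp [hy]
  have hkill : ∀ v, ∑ i, y i * D v i = 0 := by
    intro v
    have h1 := LinearMap.congr_fun hg v
    rw [← Finset.sum_subset (Finset.subset_univ T) (fun i _ hi => by simp [hyT i hi]),
      ← Finset.sum_coe_sort T]
    simpa [hyg, LinearMap.sum_apply] using h1
  have hne : y ≠ 0 := fun h0 => hi0 (by rw [← hyg, h0]; rfl)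
  obtain ⟨l, hlen, hl⟩ := h y hne hkill
  have hl0 := ne_zero_of_mem_alternation (by omega) hl
  have hlT : ∀ i ∈ l, i ∈ T := fun i hi => by
    by_contra hiT
    exact hl0 i hi (hyT i hiT)
  have heq : l.toFinset = T := by
    refine Finset.eq_of_subset_of_card_le (fun i hi => hlT i (List.mem_toFinset.1 hi)) ?_
    rw [List.toFinset_card_of_nodup (pairwise_lt_of_alternation hl).nodup]
    omega
  have hmem : ∀ i, i ∈ l ↔ i ∈ T := fun i => by rw [← heq, List.mem_toFinset]
  refine ⟨y, hkill, fun i => ⟨fun hi => ?_, fun hi => hl0 i ((hmem i).2 hi)⟩, l, hmem, hl⟩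
  by_contra hiT
  exact hi (hyT i hiT)

/-- A weakly alternating sequence of `e + 2` coordinates of `D v` meets the alternating relation
between these coordinates in summands of one sign, so that they all vanish; exchanging one index at
a time, all coordinates vanish. -/
theorem not_hasWeakAlternation_sign [FiniteDimensional ℝ V]
    (D : V →ₗ[ℝ] (ι → ℝ)) {e : ℕ}
    (hV : Module.finrank ℝ V ≤ e + 1)
    (h : ∀ y : ι → ℝ, y ≠ 0 → (∀ v, ∑ i, y i * D v i = 0) → HasAlternation y (e + 2))
    (v : V) (hv : D v ≠ 0) : ¬ HasWeakAlternation (fun i => SignType.sign (D v i)) (e + 2) := by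
  rintro ⟨w, hlen, hw, hcomp⟩
  beta_reduce at hcomp
  have hsorted : (w.map Prod.fst).Pairwise (· < ·) :=
    List.isChain_iff_pairwise.1 ((List.isChain_map _).2 (hw.imp fun _ _ h => h.1))
  set T := (w.map Prod.fst).toFinset with hTdef
  have hTcard : T.card = e + 2 := by
    rw [hTdef, List.toFinset_card_of_nodup hsorted.nodup, List.length_map, hlen]
  obtain ⟨y, hy, hyT, l, hl, hlc⟩ := exists_alternating_relation D hV h T hTcard
  have hlw : l = w.map Prod.fst :=
    (pairwise_lt_of_alternation hlc).eq_of_mem_iff hsorted fun i => by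
      rw [hl, hTdef, List.mem_toFinset]
  obtain ⟨w0, w', rfl⟩ : ∃ w0 w', w = w0 :: w' := by
    cases w with
    | nil => simp at hlen
    | cons a w' => exact ⟨a, w', rfl⟩
  set δ : SignType := SignType.sign (y w0.1) * w0.2 with hδ
  have hsq : ∀ s : SignType, s ≠ 0 → s * s = 1 := by decide
  have hsign : ∀ a ∈ w0 :: w', SignType.sign (y a.1) = δ * a.2 := by
    rw [hlw, List.isChain_map] at hlc
    have hboth : (w0 :: w').IsChain fun a b => b.2 = -a.2 ∧ y a.1 * y b.1 < 0 := by
      rw [List.isChain_iff_getElem] at hw hlc ⊢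
      exact fun i hi => ⟨(hw i hi).2, (hlc i hi).2⟩
    refine hboth.induction (fun a => SignType.sign (y a.1) = δ * a.2) _ ?_ ?_
    · rintro a b ⟨hab, hlt⟩ ha
      have h1 : SignType.sign (y a.1) * SignType.sign (y b.1) = -1 := by
        rw [← sign_mul, sign_neg hlt]
      rw [hab]
      rw [ha] at h1
      revert h1
      generalize SignType.sign (y b.1) = p
      generalize a.2 = q
      generalize δ = r
      revert p q r
      decide
    · intro _
      simp only [List.head_cons, hδ]
      rw [mul_assoc, hsq _ (hcomp w0 (by simp)).1, mul_one]
  have hterm : ∀ i ∈ T, SignType.sign (y i * D v i) = 0 ∨ SignType.sign (y i * D v i) = δ := by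
    intro i hi
    obtain ⟨a, ha, rfl⟩ := List.mem_map.1 (List.mem_toFinset.1 hi)
    rw [sign_mul, hsign a ha]
    obtain ⟨h0, h1⟩ := hcomp a ha
    rcases h1 with h1 | h1
    · simp [h1]
    · right
      rw [h1, mul_assoc, hsq _ h0, mul_one]
  have hsum : ∑ i ∈ T, y i * D v i = 0 := by
    rw [← hy v]
    refine Finset.sum_subset (Finset.subset_univ T) fun i _ hi => ?_
    have : y i = 0 := by_contra fun h => hi ((hyT i).1 h)
    simp [this]
  have hzero : ∀ i ∈ T, y i * D v i = 0 := by
    rcases SignType.trichotomy δ with hd | hd | hd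
    · refine (Finset.sum_eq_zero_iff_of_nonpos fun i hi => ?_).1 hsum
      rcases hterm i hi with h | h
      · exact (sign_eq_zero_iff.1 h).le
      · exact (sign_eq_neg_one_iff.1 (h.trans hd)).le
    · intro i hi
      rcases hterm i hi with h | h
      · exact sign_eq_zero_iff.1 h
      · exact sign_eq_zero_iff.1 (h.trans hd)
    · refine (Finset.sum_eq_zero_iff_of_nonneg fun i hi => ?_).1 hsum
      rcases hterm i hi with h | h
      · exact (sign_eq_zero_iff.1 h).ge
      · exact (sign_eq_one_iff.1 (h.trans hd)).le
  have hDT : ∀ i ∈ T, D v i = 0 := fun i hi =>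
    (mul_eq_zero.1 (hzero i hi)).resolve_left ((hyT i).2 hi)
  apply hv
  funext j
  by_cases hj : j ∈ T
  · exact hDT j hj
  have hi0 : w0.1 ∈ T := List.mem_toFinset.2 (by simp)
  obtain ⟨y', hy', hyT', -⟩ := exists_alternating_relation D hV h (insert j (T.erase w0.1)) (by
    rw [Finset.card_insert_of_notMem (fun hm => hj (Finset.mem_of_mem_erase hm)),
      Finset.card_erase_of_mem hi0]
    omega)
  have hs := hy' v
  rw [Finset.sum_eq_single j] at hs
  · exact (mul_eq_zero.1 hs).resolve_left ((hyT' j).2 (Finset.mem_insert_self _ _))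
  · intro i _ hij
    by_cases hiT : i ∈ T
    · simp [hDT i hiT]
    · have : y' i = 0 := by
        by_contra h0
        rcases Finset.mem_insert.1 ((hyT' i).1 h0) with h1 | h1
        · exact hij h1
        · exact hiT (Finset.mem_of_mem_erase h1)
      simp [this]
  · simp

/-- If no vector `D v` has the sign vector `μ`, then separating the open orthant of `μ` from the
range of `D` gives a linear relation between the coordinates of `D` whose coefficients have the
signs of `μ` on the support of `μ`. -/
theorem exists_relation_of_not_realizable (D : V →ₗ[ℝ] (ι → ℝ)) (μ : ι → SignType)
    (hμ : ¬ ∃ v, ∀ i, SignType.sign (D v i) = μ i) :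
    ∃ y : ι → ℝ, y ≠ 0 ∧ (∀ v, ∑ i, y i * D v i = 0) ∧
      ∀ i, μ i ≠ 0 → y i ≠ 0 → SignType.sign (y i) = μ i := by
  classical
  let L : {i // μ i = 0} → V →ₗ[ℝ] ℝ := fun i => LinearMap.proj (i : ι) ∘ₗ D
  let Z : Submodule ℝ V := ⨅ i, LinearMap.ker (L i)
  let DS : V →ₗ[ℝ] ({i // μ i ≠ 0} → ℝ) := LinearMap.pi fun i => LinearMap.proj (i : ι) ∘ₗ D
  let W : Submodule ℝ ({i // μ i ≠ 0} → ℝ) := Z.map DS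
  let C : Set ({i // μ i ≠ 0} → ℝ) := {w | ∀ i : {i // μ i ≠ 0}, 0 < (μ i : ℝ) * w i}
  have hZ : ∀ v, v ∈ Z ↔ ∀ i, μ i = 0 → D v i = 0 := by
    intro v
    simp [Z, L, Submodule.mem_iInf]
  have hsg : ∀ s : SignType, s ≠ 0 → ∀ x : ℝ, 0 < (s : ℝ) * x ↔ SignType.sign x = s := by
    intro s hs x
    rcases SignType.trichotomy s with rfl | rfl | rfl
    · simp [sign_eq_neg_one_iff]
    · exact absurd rfl hs
    · simp [sign_eq_one_iff]
  have hCo : IsOpen C := by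
    have : C = ⋂ i : {i // μ i ≠ 0}, {w | 0 < (μ i : ℝ) * w i} := by ext w; simp [C]
    rw [this]
    exact isOpen_iInter_of_finite fun i =>
      isOpen_lt continuous_const (continuous_const.mul (continuous_apply i))
  have hCc : Convex ℝ C := by
    intro x hx z hz a b ha hb hab i
    have h1 := hx i
    have h2 := hz i
    simp only [Pi.add_apply, Pi.smul_apply, smul_eq_mul]
    rcases ha.eq_or_lt with rfl | ha
    · have : b = 1 := by linarith
      subst this
      simpa using h2
    · have h3 := mul_pos ha h1
      have h4 := mul_nonneg hb h2.le
      nlinarith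
  have hdisj : Disjoint C (W : Set ({i // μ i ≠ 0} → ℝ)) := by
    rw [Set.disjoint_left]
    rintro w hw ⟨v, hv, rfl⟩
    refine hμ ⟨v, fun i => ?_⟩
    by_cases hi : μ i = 0
    · rw [hi, (hZ v).1 hv i hi, sign_zero]
    · exact (hsg _ hi _).1 (hw ⟨i, hi⟩)
  obtain ⟨φ, u, hφC, hφW⟩ := geometric_hahn_banach_open hCc hCo W.convex hdisj
  have hu : u ≤ 0 := by simpa using hφW 0 W.zero_mem
  have hφW0 : ∀ w ∈ W, φ w = 0 := by
    intro w hw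
    by_contra hne
    have h1 := hφW (((u - 1) / φ w) • w) (W.smul_mem _ hw)
    rw [map_smul, smul_eq_mul, div_mul_cancel₀ _ hne] at h1
    linarith
  let c : {i // μ i ≠ 0} → ℝ := fun i => φ (Pi.single i 1)
  have hφ : ∀ w, φ w = ∑ i, w i * c i := by
    intro w
    conv_lhs => rw [← Finset.univ_sum_single w]
    rw [map_sum]
    refine Finset.sum_congr rfl fun i _ => ?_
    have : (Pi.single i (w i) : {i // μ i ≠ 0} → ℝ) = w i • Pi.single i 1 := by
      rw [← Pi.single_smul, smul_eq_mul, mul_one]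
    rw [this, map_smul, smul_eq_mul]
  -- the signs of the coefficients: `φ` is negative on the orthant, up to its boundary
  have hc : ∀ i : {i // μ i ≠ 0}, (μ i : ℝ) * c i ≤ 0 := by
    intro i
    by_contra! hpos
    have hμμ : ∀ j : {i // μ i ≠ 0}, (μ j : ℝ) * (μ j : ℝ) = 1 := by
      rintro ⟨j, hj⟩
      rcases SignType.trichotomy (μ j) with h | h | h
      · simp [h]
      · exact absurd h hj
      · simp [h]
    set K := ∑ j : {i // μ i ≠ 0}, (μ j : ℝ) * c j with hK
    have hmem : (fun j : {i // μ i ≠ 0} => (μ j : ℝ)) +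
        ((|K| + 1) / ((μ i : ℝ) * c i)) • Pi.single i (μ i : ℝ) ∈ C := by
      intro j
      have hq : 0 ≤ (|K| + 1) / ((μ i : ℝ) * c i) := by positivity
      by_cases hj : j = i
      · subst hj
        simp only [Pi.add_apply, Pi.smul_apply, Pi.single_eq_same, smul_eq_mul]
        have := hμμ j
        nlinarith
      · simp only [Pi.add_apply, Pi.smul_apply, Pi.single_eq_of_ne hj, smul_eq_mul, mul_zero,
          add_zero, hμμ]
        exact one_pos
    have h1 := hφC _ hmem
    have hs : φ (Pi.single i (μ i : ℝ)) = (μ i : ℝ) * c i := by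
      rw [hφ, Finset.sum_eq_single i]
      · simp
      · intro j _ hj
        simp [hj]
      · simp
    rw [map_add, map_smul, hs, hφ, smul_eq_mul, div_mul_cancel₀ _ hpos.ne'] at h1
    have := neg_abs_le K
    linarith
  have hker : (⨅ i, LinearMap.ker (L i)) ≤ LinearMap.ker ((φ : _ →ₗ[ℝ] ℝ) ∘ₗ DS) := by
    intro v hv
    exact hφW0 _ ⟨v, hv, rfl⟩
  obtain ⟨b, hb⟩ := (Submodule.mem_span_range_iff_exists_fun ℝ).1 (mem_span_of_iInf_ker_le_ker hker)
  refine ⟨fun i => if hi : μ i = 0 then b ⟨i, hi⟩ else -c ⟨i, hi⟩, ?_, ?_, ?_⟩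
  · intro h0
    have hc0 : ∀ i, c i = 0 := by
      rintro ⟨i, hi⟩
      simpa [hi] using congrFun h0 i
    have hmem : (fun j : {i // μ i ≠ 0} => (μ j : ℝ)) ∈ C := by
      rintro ⟨j, hj⟩
      exact (hsg _ hj _).2 (by rcases SignType.trichotomy (μ j) with h | h | h <;> simp_all)
    have h1 := hφC _ hmem
    rw [hφ] at h1
    simp only [hc0, mul_zero, Finset.sum_const_zero] at h1
    linarith
  · intro v
    have h1 := LinearMap.congr_fun hb v
    simp only [LinearMap.sum_apply, LinearMap.smul_apply, smul_eq_mul, LinearMap.comp_apply] at h1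
    have h2 : (φ : _ →ₗ[ℝ] ℝ) (DS v) = ∑ i, DS v i * c i := hφ _
    rw [h2] at h1
    rw [← Fintype.sum_subtype_add_sum_subtype (fun i => μ i = 0)]
    have e1 : ∀ i : {i // μ i = 0}, (if hi : μ i = 0 then b ⟨i, hi⟩ else -c ⟨i, hi⟩) * D v i
        = b i * L i v := by
      rintro ⟨i, hi⟩
      simp [hi, L]
    have e2 : ∀ i : {i // ¬ μ i = 0}, (if hi : μ i = 0 then b ⟨i, hi⟩ else -c ⟨i, hi⟩) * D v i
        = -(DS v i * c i) := by
      rintro ⟨i, hi⟩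
      simp [hi, DS, mul_comm]
    rw [Finset.sum_congr rfl fun i _ => e1 i, Finset.sum_congr rfl fun i _ => e2 i, h1,
      Finset.sum_neg_distrib]
    exact add_neg_cancel _
  · intro i hi hy
    simp only [hi, dite_false] at hy ⊢
    refine (hsg _ hi _).1 (lt_of_le_of_ne (by have := hc ⟨i, hi⟩; simp only at this; linarith) ?_)
    refine (mul_ne_zero ?_ hy).symm
    rcases SignType.trichotomy (μ i) with h | h | h <;> simp_all

/-- The sign vectors realized by a linear family `D` of dimension at most `e + 1`, all of whose
linear relations alternate `e + 2` times, are those without a weak alternation of length `e + 2`. -/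
theorem exists_sign_eq_iff [FiniteDimensional ℝ V]
    (D : V →ₗ[ℝ] (ι → ℝ)) {e : ℕ} (hV : Module.finrank ℝ V ≤ e + 1)
    (h : ∀ y : ι → ℝ, y ≠ 0 → (∀ v, ∑ i, y i * D v i = 0) → HasAlternation y (e + 2))
    (μ : ι → SignType) :
    (∃ v, ∀ i, SignType.sign (D v i) = μ i) ↔ μ = 0 ∨ ¬ HasWeakAlternation μ (e + 2) := by
  constructor
  · rintro ⟨v, hv⟩
    obtain rfl : (fun i => SignType.sign (D v i)) = μ := funext hv
    by_cases h0 : D v = 0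
    · left
      funext i
      simp [h0]
    · exact Or.inr (not_hasWeakAlternation_sign D hV h v h0)
  · rintro (rfl | hμ)
    · exact ⟨0, by simp⟩
    · by_contra hcon
      obtain ⟨y, hy0, hy, hsgn⟩ := exists_relation_of_not_realizable D μ hcon
      obtain ⟨l, hlen, hl⟩ := h y hy0 hy
      have hl0 := ne_zero_of_mem_alternation (by omega) hl
      refine hμ ⟨l.map fun i => (i, SignType.sign (y i)), by simpa using hlen, ?_, ?_⟩
      · rw [List.isChain_map]
        refine hl.imp fun a b hab => ⟨hab.1, ?_⟩
        have h1 : SignType.sign (y a) * SignType.sign (y b) = -1 := by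
          rw [← sign_mul, sign_neg hab.2]
        revert h1
        simp only
        generalize SignType.sign (y b) = p
        generalize SignType.sign (y a) = q
        revert p q
        decide
      · intro a ha
        obtain ⟨i, hi, rfl⟩ := List.mem_map.1 ha
        refine ⟨fun h0 => hl0 i hi (sign_eq_zero_iff.1 h0), ?_⟩
        by_cases h0 : μ i = 0
        · exact Or.inl h0
        · exact Or.inr (hsgn i h0 (hl0 i hi)).symm

end Realizable

/-! ### The statistic `m` as a number of sign changes -/

/-- The sign just before index `j` of the sequence obtained from `L` by letting every run of zeros
after a nonzero entry continue that entry with alternating signs; it is `0` as long as no nonzero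
entry has occurred. -/
def tailSign (L : ℕ → SignType) : ℕ → SignType
  | 0 => 0
  | j + 1 => if L j = 0 then -tailSign L j else L j

/-- The number of steps below `j` in which `tailSign L` changes its sign or remains `0`. -/
def gapCount (L : ℕ → SignType) : ℕ → ℕ
  | 0 => 0
  | j + 1 => gapCount L j + if tailSign L (j + 1) = -tailSign L j then 1 else 0

theorem tailSign_eq_zero {L : ℕ → SignType} {j : ℕ} (h : ∀ i < j, L i = 0) : tailSign L j = 0 := by
  induction j with
  | zero => rfl
  | succ j ih =>
    simp [tailSign, h j (by omega), ih fun i hi => h i (by omega)]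

theorem tailSign_eq_of_last {L : ℕ → SignType} {i : ℕ} (hi : L i ≠ 0) (k : ℕ)
    (h : ∀ r, i < r → r ≤ i + k → L r = 0) :
    tailSign L (i + k + 1) = if Even k then L i else -L i := by
  induction k with
  | zero => simp [tailSign, hi]
  | succ k ih =>
    rw [← add_assoc, tailSign, if_pos (h _ (by omega) (by omega)),
      ih fun r h1 h2 => h r h1 (by omega)]
    by_cases hk : Even k <;> simp [hk, Nat.even_add_one]

theorem zero_of_tailSign_eq_zero {L : ℕ → SignType} {j : ℕ} (h : tailSign L j = 0) :
    ∀ i < j, L i = 0 := by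
  induction j with
  | zero => simp
  | succ j ih =>
    rw [tailSign] at h
    split_ifs at h with hL
    · intro i hi
      rcases Nat.lt_succ_iff_lt_or_eq.1 hi with h1 | rfl
      · exact ih (by simpa using congrArg Neg.neg h) i h1
      · exact hL
    · exact absurd h hL

/-- No filling of the zeros has more sign changes than `gapCount`. Chains are listed with their last
index first, so that they grow with `j`. -/
theorem length_le_gapCount (L : ℕ → SignType) (j : ℕ) :
    ∀ (x : ℕ × SignType) (w : List (ℕ × SignType)),
      ((x :: w).IsChain fun a b => b.1 < a.1 ∧ a.2 = -b.2) →
      (∀ a ∈ x :: w, a.2 ≠ 0 ∧ (L a.1 = 0 ∨ L a.1 = a.2)) → x.1 < j →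
      (x :: w).length + (if x.2 = tailSign L j then 0 else 1) ≤ gapCount L j + 1 := by
  induction j with
  | zero => simp
  | succ j ih =>
    intro x w hc hcomp hx
    have hx0 := (hcomp x (by simp)).1
    rw [gapCount]
    rcases Nat.lt_succ_iff_lt_or_eq.1 hx with h1 | h1
    · have h2 := ih x w hc hcomp h1
      have key : (if x.2 = tailSign L (j + 1) then 0 else 1) ≤
          (if x.2 = tailSign L j then 0 else 1) +
            (if tailSign L (j + 1) = -tailSign L j then 1 else 0) := by
        rw [tailSign]
        revert hx0
        generalize x.2 = p
        generalize tailSign L j = q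
        generalize L j = r
        revert p q r
        decide
      omega
    · have hxL : L j = 0 ∨ L j = x.2 := h1 ▸ (hcomp x (by simp)).2
      cases w with
      | nil =>
        have key : (if x.2 = tailSign L (j + 1) then 0 else 1) ≤
            (if tailSign L (j + 1) = -tailSign L j then 1 else 0) := by
          rw [tailSign]
          revert hx0 hxL
          generalize x.2 = p
          generalize tailSign L j = q
          generalize L j = r
          revert p q r
          decide
        simp only [List.length_singleton]
        omega
      | cons z w =>
        obtain ⟨⟨hzx, hsg⟩, hc'⟩ := List.isChain_cons_cons.1 hc
        have h2 := ih z w hc' (fun a ha => hcomp a (by simp [ha])) (h1 ▸ hzx)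
        have key : 1 + (if x.2 = tailSign L (j + 1) then 0 else 1) ≤
            (if z.2 = tailSign L j then 0 else 1) +
              (if tailSign L (j + 1) = -tailSign L j then 1 else 0) := by
          rw [tailSign]
          rw [hsg] at hx0 hxL ⊢
          revert hx0 hxL
          generalize z.2 = p
          generalize tailSign L j = q
          generalize L j = r
          revert p q r
          decide
        simp only [List.length_cons] at h2 ⊢
        omega

/-- The filling by `tailSign`, alternating also before the first nonzero entry, attains the bound. -/
theorem exists_chain_gapCount (L : ℕ → SignType) (j : ℕ) :
    ∀ s : SignType, s ≠ 0 → (tailSign L j = 0 ∨ tailSign L j = s) →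
      ∃ w : List (ℕ × SignType), (w.IsChain fun a b => b.1 < a.1 ∧ a.2 = -b.2) ∧
        (∀ a ∈ w, a.2 ≠ 0 ∧ (L a.1 = 0 ∨ L a.1 = a.2)) ∧ (∀ a ∈ w, a.1 < j) ∧
        (∀ a ∈ w.head?, a.2 = s) ∧
        w.length = gapCount L j + if tailSign L j = 0 then 0 else 1 := by
  induction j with
  | zero =>
    intro s _ _
    exact ⟨[], by simp, by simp, by simp, by simp, by simp [gapCount, tailSign]⟩
  | succ j ih =>
    intro s hs hts
    by_cases happ : (tailSign L j = 0 ∨ tailSign L j = -s) ∧ (L j = 0 ∨ L j = s)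
    · obtain ⟨w, hc, hcomp, hlt, hhead, hlen⟩ := ih (-s)
        ((by decide : ∀ s : SignType, s ≠ 0 → -s ≠ 0) s hs) happ.1
      refine ⟨(j, s) :: w, List.isChain_cons.2 ⟨fun a ha => ⟨hlt a (List.mem_of_mem_head? ha), ?_⟩,
        hc⟩, ?_, ?_, by simp, ?_⟩
      · rw [hhead a ha, neg_neg]
      · rintro a ha
        rcases List.mem_cons.1 ha with rfl | ha
        · exact ⟨hs, happ.2⟩
        · exact hcomp a ha
      · rintro a ha
        rcases List.mem_cons.1 ha with rfl | ha
        · simp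
        · exact (hlt a ha).trans (by omega)
      · rw [List.length_cons, hlen, gapCount, add_assoc, add_assoc]
        congr 1
        clear hhead
        rw [tailSign] at hts ⊢
        revert hts happ hs
        generalize tailSign L j = q
        generalize L j = r
        revert s q r
        decide
    · have hτ : tailSign L j = 0 ∨ tailSign L j = s := by
        rw [tailSign] at hts
        revert hts happ hs
        generalize tailSign L j = q
        generalize L j = r
        revert s q r
        decide
      obtain ⟨w, hc, hcomp, hlt, hhead, hlen⟩ := ih s hs hτ
      refine ⟨w, hc, hcomp, fun a ha => (hlt a ha).trans (by omega), hhead, ?_⟩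
      rw [hlen, gapCount, add_assoc]
      congr 1
      clear hhead
      rw [tailSign] at hts ⊢
      rcases hτ with h | h
      · rw [h] at hts happ ⊢
        revert hts happ hs
        generalize L j = r
        revert s r
        decide
      · rw [h] at hts happ ⊢
        clear h
        revert hts happ hs
        generalize L j = r
        revert s r
        decide

section Fin

variable {N : ℕ} (l : Fin N → SignType)

/-- The extension of a sign vector by zeros. -/
def extendSign (j : ℕ) : SignType :=
  if h : j < N then l ⟨j, h⟩ else 0

theorem extendSign_coe (i : Fin N) : extendSign l i = l i := by
  simp [extendSign]

/-- An index contributes to `m` as a zero entry or as the right end of a gap, and it is the right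
end of at most one gap. -/
theorem sum_gaps_eq (j : Fin N) :
    (∑ i, if (i < j ∧ l i ≠ 0 ∧ l j ≠ 0 ∧ l i ≠ l j ∧ (∀ r, i < r → r < j → l r = 0) ∧
        Even ((j : ℕ) - (i : ℕ) - 1)) then 1 else 0) +
      (∑ i, if (i < j ∧ l i ≠ 0 ∧ l j ≠ 0 ∧ l i = l j ∧ (∀ r, i < r → r < j → l r = 0) ∧
        Odd ((j : ℕ) - (i : ℕ) - 1)) then 1 else 0) + (if l j = 0 then 1 else 0) =
      if tailSign (extendSign l) (j + 1) = -tailSign (extendSign l) j then 1 else 0 := by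
  by_cases hj : l j = 0
  · simp [hj, tailSign, extendSign_coe]
  by_cases hz : ∀ i < j, l i = 0
  · have h1 : tailSign (extendSign l) j = 0 := by
      refine tailSign_eq_zero fun i hi => ?_
      have := hz ⟨i, hi.trans j.2⟩ hi
      rw [← this, ← extendSign_coe l]
    have h2 : ∀ i : Fin N, ¬ (i < j ∧ l i ≠ 0) := fun i hi => hi.2 (hz i hi.1)
    rw [tailSign, extendSign_coe, if_neg hj, h1]
    simp only [← and_assoc, h2, false_and, if_false, Finset.sum_const_zero, neg_zero, hj, add_zero]
  · -- the last nonzero entry before `j` is the only possible left end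
    push Not at hz
    obtain ⟨i, hi⟩ := (Finset.univ.filter fun i => i < j ∧ l i ≠ 0).exists_maximal
      (by obtain ⟨i, h1, h2⟩ := hz; exact ⟨i, by simp [h1, h2]⟩)
    have hij : i < j ∧ l i ≠ 0 := by simpa using hi.prop
    have hlast : ∀ r, i < r → r < j → l r = 0 := by
      intro r h1 h2
      by_contra h3
      exact absurd (hi.le_of_ge (by simp [h2, h3]) h1.le) (not_le.2 h1)
    have huniq : ∀ i', i' ≠ i → ¬ (i' < j ∧ l i' ≠ 0 ∧ ∀ r, i' < r → r < j → l r = 0) := by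
      rintro i' hne ⟨h1, h2, h3⟩
      rcases lt_or_gt_of_ne hne with h | h
      · exact hij.2 (h3 i h hij.1)
      · exact h2 (hlast i' h h1)
    have hτ : tailSign (extendSign l) j =
        if Even ((j : ℕ) - (i : ℕ) - 1) then l i else -l i := by
      have hji : (i : ℕ) + ((j : ℕ) - (i : ℕ) - 1) + 1 = j := by
        have : (i : ℕ) < j := hij.1
        omega
      have := tailSign_eq_of_last (L := extendSign l) (i := i) (by rw [extendSign_coe]; exact hij.2)
        ((j : ℕ) - (i : ℕ) - 1) (fun r h1 h2 => by
          have := hlast ⟨r, by omega⟩ h1 (show r < (j : ℕ) by omega)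
          rw [← this, ← extendSign_coe l])
      rwa [hji, extendSign_coe] at this
    rw [Finset.sum_eq_single i (fun i' _ h => if_neg fun h' => huniq i' h
        ⟨h'.1, h'.2.1, h'.2.2.2.2.1⟩) (by simp),
      Finset.sum_eq_single i (fun i' _ h => if_neg fun h' => huniq i' h
        ⟨h'.1, h'.2.1, h'.2.2.2.2.1⟩) (by simp), tailSign, extendSign_coe, hτ, if_neg hj]
    by_cases hE : Even ((j : ℕ) - (i : ℕ) - 1)
    · simp only [hij.1, hE, ← Nat.not_even_iff_odd, eq_true hlast, not_true_eq_false, and_false,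
        if_false,
        if_true, hj, ne_eq, not_false_eq_true, true_and, hij.2, and_true, add_zero]
      have : ∀ p q : SignType, p ≠ 0 → q ≠ 0 →
          ((if ¬ p = q then 1 else 0) : ℕ) = if q = -p then 1 else 0 := by decide
      exact this _ _ hij.2 hj
    · simp only [hij.1, hE, ← Nat.not_even_iff_odd, eq_true hlast, not_false_eq_true, and_false,
        if_false,
        hj, ne_eq, true_and, hij.2, and_true, add_zero, zero_add, neg_neg]
      exact if_congr eq_comm rfl rfl

theorem gapNumber_eq_gapCount : gapNumber l = gapCount (extendSign l) N := by
  have hG : ∀ j, gapCount (extendSign l) j = ∑ i ∈ Finset.range j,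
      if tailSign (extendSign l) (i + 1) = -tailSign (extendSign l) i then 1 else 0 := by
    intro j
    induction j with
    | zero => rfl
    | succ j ih => rw [gapCount, ih, Finset.sum_range_succ]
  rw [hG, Finset.sum_range, gapNumber, evenGaps, oddGaps, Finset.card_filter, Finset.card_filter,
    Finset.card_filter, Fintype.sum_prod_type_right, Fintype.sum_prod_type_right,
    ← Finset.sum_add_distrib, ← Finset.sum_add_distrib]
  exact Finset.sum_congr rfl fun j _ => sum_gaps_eq l j

/-- For a nonzero sign vector, `m` is the largest number of sign changes that can be obtained by
replacing the zeros by signs. -/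
theorem gapNumber_le_iff (hl : l ≠ 0) (e : ℕ) :
    gapNumber l ≤ e ↔ ¬ HasWeakAlternation l (e + 2) := by
  have hτ : tailSign (extendSign l) N ≠ 0 := by
    intro h
    apply hl
    funext i
    rw [← extendSign_coe l]
    exact zero_of_tailSign_eq_zero h i i.2
  rw [gapNumber_eq_gapCount, ← not_lt, not_iff_not]
  constructor
  · intro h
    obtain ⟨w, hc, hcomp, hlt, -, hlen⟩ := exists_chain_gapCount (extendSign l) N _ hτ (Or.inr rfl)
    rw [if_neg hτ] at hlen
    have hc' : (w.take (e + 2)).IsChain fun a b => b.1 < a.1 ∧ a.2 = -b.2 := hc.take _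
    refine ⟨((w.take (e + 2)).pmap (fun a (ha : a.1 < N) => ((⟨a.1, ha⟩ : Fin N), a.2))
      fun a ha => hlt a (List.mem_of_mem_take ha)).reverse, ?_, ?_, ?_⟩
    · simp only [List.length_reverse, List.length_pmap, List.length_take]
      omega
    · rw [List.isChain_reverse, List.isChain_iff_getElem]
      rw [List.isChain_iff_getElem] at hc'
      intro i hi
      simp only [List.getElem_pmap]
      exact hc' i (by simpa using hi)
    · intro a ha
      obtain ⟨b, hb, rfl⟩ := List.mem_pmap.1 (List.mem_reverse.1 ha)
      have := hcomp b (List.mem_of_mem_take hb)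
      simpa [extendSign, hlt b (List.mem_of_mem_take hb)] using this
  · rintro ⟨w, hlen, hc, hcomp⟩
    obtain ⟨x, w', hw⟩ : ∃ x w', w.reverse.map (fun a => ((a.1 : ℕ), a.2)) = x :: w' := by
      cases hw : w.reverse.map (fun a => ((a.1 : ℕ), a.2)) with
      | nil => simp at hw; simp [hw] at hlen
      | cons x w' => exact ⟨x, w', rfl⟩
    have hmem : ∀ a ∈ x :: w', ∃ b ∈ w, a = ((b.1 : ℕ), b.2) := by
      intro a ha
      rw [← hw] at ha
      obtain ⟨b, hb, rfl⟩ := List.mem_map.1 ha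
      exact ⟨b, List.mem_reverse.1 hb, rfl⟩
    have h := length_le_gapCount (extendSign l) N x w' (by
        rw [← hw, List.isChain_map, List.isChain_reverse]
        exact hc) (by
        intro a ha
        obtain ⟨b, hb, rfl⟩ := hmem a ha
        simpa [extendSign_coe] using hcomp b hb) (by
        obtain ⟨b, -, hb⟩ := hmem x (by simp)
        rw [hb]
        exact b.1.2)
    have hlen' : (x :: w').length = e + 2 := by rw [← hw]; simpa using hlen
    omega

end Fin

/-! ### Polynomials with prescribed signs -/

open Polynomial in
/-- A function with at most `k` sign changes has weakly the same signs as some nonzero polynomial of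
degree at most `k`: each linear factor removes the leftmost sign change. -/
theorem exists_polynomial_mul_nonneg {a : ℝ} (k : ℕ) :
    ∀ ψ : ℝ → ℝ, (∀ x, ψ x ≠ 0 → a ≤ x) → ¬ HasAlternation ψ (k + 2) →
      ∃ q : ℝ[X], q ≠ 0 ∧ q.natDegree ≤ k ∧ ∀ x, 0 ≤ q.eval x * ψ x := by
  have base : ∀ (k : ℕ) (ψ : ℝ → ℝ), (¬ ∃ v u, u < v ∧ ψ u * ψ v < 0) →
      ∃ q : ℝ[X], q ≠ 0 ∧ q.natDegree ≤ k ∧ ∀ x, 0 ≤ q.eval x * ψ x := by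
    intro k ψ h
    push Not at h
    have h' : ∀ u v, 0 ≤ ψ u * ψ v := by
      intro u v
      rcases lt_trichotomy u v with h1 | rfl | h1
      · exact h v u h1
      · exact mul_self_nonneg _
      · rw [mul_comm]
        exact h u v h1
    by_cases hp : ∃ u, 0 < ψ u
    · obtain ⟨u, hu⟩ := hp
      refine ⟨1, one_ne_zero, by simp, fun x => ?_⟩
      rw [eval_one, one_mul]
      exact nonneg_of_mul_nonneg_right (h' u x) hu
    · push Not at hp
      refine ⟨-1, by simp, by simp, fun x => ?_⟩
      have := hp x
      simp only [eval_neg, eval_one]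
      linarith
  induction k with
  | zero =>
    intro ψ _ hψ
    refine base 0 ψ ?_
    rintro ⟨v, u, huv, h⟩
    exact hψ ⟨[u, v], rfl, by simp [huv, h]⟩
  | succ k ih =>
    intro ψ ha hψ
    by_cases hA : ∃ v u, u < v ∧ ψ u * ψ v < 0
    swap
    · exact base _ ψ hA
    have hbdd : BddBelow {v | ∃ u, u < v ∧ ψ u * ψ v < 0} := by
      refine ⟨a, ?_⟩
      rintro v ⟨u, -, h⟩
      exact ha v fun h0 => by simp [h0] at h
    set z := sInf {v | ∃ u, u < v ∧ ψ u * ψ v < 0} with hz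
    have hleft : ∀ v < z, ∀ u < v, 0 ≤ ψ u * ψ v := by
      intro v hv u huv
      by_contra! hneg
      exact absurd (csInf_le hbdd ⟨u, huv, hneg⟩) (not_le.2 hv)
    have hright : ∀ x, z < x → ∃ v, z ≤ v ∧ v < x ∧ ∃ u, u < v ∧ ψ u * ψ v < 0 := by
      intro x hx
      obtain ⟨v, hv, hvx⟩ := exists_lt_of_csInf_lt hA hx
      exact ⟨v, csInf_le hbdd hv, hvx, hv⟩
    obtain ⟨q, hq0, hqd, hq⟩ := ih (fun x => ψ x * (x - z))
      (fun x hx => ha x (left_ne_zero_of_mul hx)) (by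
        rintro ⟨l, hlen, hl⟩
        have hl0 := ne_zero_of_mem_alternation (by omega) hl
        obtain ⟨y₁, y₂, l, rfl⟩ : ∃ y₁ y₂ l', l = y₁ :: y₂ :: l' := by
          match l, hlen with
          | y₁ :: y₂ :: l', _ => exact ⟨y₁, y₂, l', rfl⟩
        obtain ⟨⟨h12, hs12⟩, hl'⟩ := List.isChain_cons_cons.1 hl
        have hy₁ := hl0 y₁ (by simp)
        have hy₂ := hl0 y₂ (by simp)
        have hy₁z : y₁ ≠ z := fun h => hy₁ (by simp [h])
        have hy₂z : z < y₂ := by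
          by_contra! hle
          have hlt : y₂ < z := lt_of_le_of_ne hle fun h => hy₂ (by simp [h])
          have h1 := hleft y₂ hlt y₁ h12
          have h2 : 0 < (y₁ - z) * (y₂ - z) := mul_pos_of_neg_of_neg (by linarith) (by linarith)
          nlinarith [mul_nonneg h1 h2.le]
        have htail : (y₂ :: l).IsChain fun a b => a < b ∧ ψ a * ψ b < 0 := by
          have hpos : ∀ x ∈ y₂ :: l, z < x := by
            refine hl'.induction _ _ ?_ (fun _ => hy₂z)
            rintro x y ⟨hxy, -⟩ hx
            exact hx.trans hxy
          refine (hl'.imp_of_mem_imp fun x y hx hy hxy => ⟨hxy.1, ?_⟩)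
          have h1 := hpos x hx
          have h2 := hpos y hy
          have h3 : 0 < (x - z) * (y - z) := mul_pos (by linarith) (by linarith)
          have h4 := hxy.2
          by_contra! h5
          nlinarith [mul_nonneg h5 h3.le]
        simp only [List.length_cons] at hlen
        rcases lt_or_gt_of_ne hy₁z with h1 | h1
        · have hsame : 0 < ψ y₁ * ψ y₂ := by
            have h3 : (y₁ - z) * (y₂ - z) < 0 := mul_neg_of_neg_of_pos (by linarith) (by linarith)
            by_contra! h5
            nlinarith [mul_nonneg_of_nonpos_of_nonpos h5 h3.le]
          obtain ⟨v, hzv, hv2, u, huv, huvs⟩ := hright y₂ hy₂z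
          rcases lt_or_ge (ψ v * ψ y₂) 0 with h2 | h2
          · refine hψ ⟨u :: v :: y₂ :: l, by simp; omega, ?_⟩
            exact List.isChain_cons_cons.2 ⟨⟨huv, huvs⟩, List.isChain_cons_cons.2
              ⟨⟨hv2, h2⟩, htail⟩⟩
          · have hv0 : ψ v ≠ 0 := fun h => by simp [h] at huvs
            have hy20 : ψ y₂ ≠ 0 := fun h => by simp [h] at hsame
            have h2' : 0 < ψ v * ψ y₂ := lt_of_le_of_ne h2 (mul_ne_zero hv0 hy20).symm
            have hu2 : ψ u * ψ y₂ < 0 := by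
              by_contra! h5
              have := mul_neg_of_neg_of_pos huvs (mul_self_pos.2 hy20)
              nlinarith [mul_nonneg h5 h2]
            have hu1 : ψ y₁ * ψ u < 0 := by
              by_contra! h5
              have := mul_neg_of_neg_of_pos hu2 (mul_self_pos.2 (left_ne_zero_of_mul hsame.ne'))
              nlinarith [mul_nonneg h5 hsame.le]
            have hlt : y₁ < u := by
              rcases lt_trichotomy y₁ u with h | rfl | h
              · exact h
              · exact absurd hu1 (not_lt.2 (mul_self_nonneg _))
              · have := hleft y₁ h1 u h
                linarith [mul_comm (ψ u) (ψ y₁)]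
            refine hψ ⟨y₁ :: u :: y₂ :: l, by simp; omega, ?_⟩
            exact List.isChain_cons_cons.2 ⟨⟨hlt, hu1⟩, List.isChain_cons_cons.2
              ⟨⟨huv.trans hv2, hu2⟩, htail⟩⟩
        · have hopp : ψ y₁ * ψ y₂ < 0 := by
            have h3 : 0 < (y₁ - z) * (y₂ - z) := mul_pos (by linarith) (by linarith)
            by_contra! h5
            nlinarith [mul_nonneg h5 h3.le]
          obtain ⟨v, hzv, hv1, u, huv, huvs⟩ := hright y₁ h1
          have hfull : (y₁ :: y₂ :: l).IsChain fun a b => a < b ∧ ψ a * ψ b < 0 :=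
            List.isChain_cons_cons.2 ⟨⟨h12, hopp⟩, htail⟩
          rcases lt_or_ge (ψ v * ψ y₁) 0 with h2 | h2
          · exact hψ ⟨v :: y₁ :: y₂ :: l, by simp; omega,
              List.isChain_cons_cons.2 ⟨⟨hv1, h2⟩, hfull⟩⟩
          · have hy10 : ψ y₁ ≠ 0 := fun h => by simp [h] at hopp
            have hu2 : ψ u * ψ y₁ < 0 := by
              by_contra! h5
              have := mul_neg_of_neg_of_pos huvs (mul_self_pos.2 hy10)
              nlinarith [mul_nonneg h5 h2]
            exact hψ ⟨u :: y₁ :: y₂ :: l, by simp; omega,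
              List.isChain_cons_cons.2 ⟨⟨huv.trans hv1, hu2⟩, hfull⟩⟩)
    refine ⟨q * (X - C z), mul_ne_zero hq0 (X_sub_C_ne_zero z), ?_, fun x => ?_⟩
    · refine natDegree_mul_le.trans ?_
      rw [natDegree_X_sub_C]
      omega
    · have := hq x
      simp only [eval_mul, eval_sub, eval_X, eval_C]
      nlinarith

open Polynomial in
/-- A nontrivial linear relation between the values at `x` of all polynomials of degree at most `d`
alternates `d + 2` times. -/
theorem hasAlternation_of_sum_eval_eq_zero {ι : Type*} [Fintype ι] [LinearOrder ι] {x : ι → ℝ}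
    (hx : StrictMono x) (d : ℕ) (y : ι → ℝ) (hy : y ≠ 0)
    (h : ∀ p : ℝ[X], p.natDegree ≤ d → ∑ i, y i * p.eval (x i) = 0) :
    HasAlternation y (d + 2) := by
  classical
  by_contra hcon
  set ψ : ℝ → ℝ := Function.extend x y 0 with hψ
  have hψx : ∀ i, ψ (x i) = y i := fun i => hx.injective.extend_apply _ _ _
  have hψ0 : ∀ s, ψ s ≠ 0 → ∃ i, x i = s := by
    intro s hs
    by_contra h0
    exact hs (Function.extend_apply' _ _ _ h0)
  obtain ⟨i0, -⟩ := Function.ne_iff.1 hy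
  have : Nonempty ι := ⟨i0⟩
  obtain ⟨im, him⟩ := Finite.exists_min x
  obtain ⟨q, hq0, hqd, hq⟩ := exists_polynomial_mul_nonneg (a := x im) d ψ
    (fun s hs => by obtain ⟨i, rfl⟩ := hψ0 s hs; exact him i) (by
      rintro ⟨l, hlen, hl⟩
      have hl0 := ne_zero_of_mem_alternation (by omega) hl
      choose! g hg using hψ0
      refine hcon ⟨l.map g, by simpa using hlen, ?_⟩
      rw [List.isChain_map]
      refine hl.imp_of_mem_imp fun s r hs hr hsr => ?_
      have h1 := hg s (hl0 s hs)
      have h2 := hg r (hl0 r hr)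
      rw [← h1, ← h2, hψx, hψx] at hsr
      exact ⟨hx.lt_iff_lt.1 hsr.1, hsr.2⟩)
  have hterm : ∀ i, y i * q.eval (x i) = 0 := by
    have h1 : ∀ i ∈ Finset.univ, 0 ≤ y i * q.eval (x i) := fun i _ => by
      have := hq (x i)
      rw [hψx] at this
      linarith
    intro i
    exact (Finset.sum_eq_zero_iff_of_nonneg h1).1 (h q hqd) i (Finset.mem_univ i)
  -- the support of `y` consists of zeros of `q`, so it is too small to support a relation
  set T := Finset.univ.filter fun i => y i ≠ 0 with hT
  have hTcard : T.card ≤ d := by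
    have h1 : T.image x ⊆ q.roots.toFinset := by
      intro s hs
      obtain ⟨i, hi, rfl⟩ := Finset.mem_image.1 hs
      rw [Multiset.mem_toFinset, mem_roots hq0]
      exact (mul_eq_zero.1 (hterm i)).resolve_left (Finset.mem_filter.1 hi).2
    calc T.card = (T.image x).card := (Finset.card_image_of_injective _ hx.injective).symm
      _ ≤ q.roots.toFinset.card := Finset.card_le_card h1
      _ ≤ q.roots.card := Multiset.toFinset_card_le _
      _ ≤ d := (card_roots' q).trans hqd
  apply hy
  funext i
  by_contra hi
  have hiT : i ∈ T := by simpa [hT] using hi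
  have h1 := h (∏ j ∈ T.erase i, (X - C (x j))) (by
    refine (natDegree_prod_le _ _).trans ?_
    simp only [natDegree_X_sub_C, Finset.sum_const, smul_eq_mul, mul_one]
    exact (Finset.card_le_card (Finset.erase_subset _ _)).trans hTcard)
  rw [Finset.sum_eq_single i] at h1
  · refine hi ((mul_eq_zero.1 h1).resolve_right ?_)
    rw [eval_prod]
    refine Finset.prod_ne_zero_iff.2 fun j hj => ?_
    simp only [eval_sub, eval_X, eval_C]
    exact sub_ne_zero.2 fun h2 => Finset.ne_of_mem_erase hj (hx.injective h2).symm
  · intro j _ hj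
    by_cases hjT : j ∈ T
    · rw [eval_prod, Finset.prod_eq_zero (Finset.mem_erase.2 ⟨hj, hjT⟩) (by simp), mul_zero]
    · have : y j = 0 := by simpa [hT] using hjT
      rw [this, zero_mul]
  · simp

open Polynomial in
theorem exists_polynomial_derivative_eq (q : ℝ[X]) :
    ∃ p : ℝ[X], derivative p = q ∧ p.natDegree ≤ q.natDegree + 1 := by
  refine ⟨∑ k ∈ Finset.range (q.natDegree + 1), monomial (k + 1) (q.coeff k / (k + 1)), ?_, ?_⟩
  · conv_rhs => rw [q.as_sum_range]
    rw [derivative_sum]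
    refine Finset.sum_congr rfl fun k _ => ?_
    have : (k : ℝ) + 1 ≠ 0 := by positivity
    rw [derivative_monomial]
    simp [div_mul_cancel₀ _ this]
  · refine natDegree_sum_le_of_forall_le _ _ fun k hk => (natDegree_monomial_le _).trans ?_
    have := Finset.mem_range.1 hk
    omega

/-! ### Hat functions and splines over a system of break points -/

/-- The second difference of `g` at `m` with respect to `a < m < c`, normalized so that it is
positive when the graph of `g` at `m` lies above the chord over `[a, c]`. -/
def secondDiff (g : ℝ → ℝ) (a m c : ℝ) : ℝ :=
  (c - a) * g m - (c - m) * g a - (m - a) * g c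

/-- The piecewise linear function supported on `[a, c]` with its peak at `m`. -/
noncomputable def hat (a m c s : ℝ) : ℝ :=
  max 0 (min ((c - m) * (s - a)) ((m - a) * (c - s)))

section Hat

variable {a m c : ℝ}

theorem hat_of_le (hc : m < c) {s : ℝ} (hs : s ≤ a) : hat a m c s = 0 :=
  max_eq_left ((min_le_left _ _).trans (by nlinarith))

theorem hat_of_ge (ha : a < m) {s : ℝ} (hs : c ≤ s) : hat a m c s = 0 :=
  max_eq_left ((min_le_right _ _).trans (by nlinarith))

theorem hat_eq_left (ha : a < m) (hc : m < c) {s : ℝ} (h1 : a ≤ s) (h2 : s ≤ m) :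
    hat a m c s = (c - m) * (s - a) := by
  rw [hat, min_eq_left (by nlinarith), max_eq_right (by nlinarith)]

theorem hat_eq_right (ha : a < m) (hc : m < c) {s : ℝ} (h1 : m ≤ s) (h2 : s ≤ c) :
    hat a m c s = (m - a) * (c - s) := by
  rw [hat, min_eq_right (by nlinarith), max_eq_right (by nlinarith)]

theorem continuous_hat : Continuous (hat a m c) := by
  unfold hat
  fun_prop

/-- Integrating against the hat function inverts taking the second derivative, up to the sign. -/
theorem integral_hat_mul {lo hi : ℝ} (hlo : lo ≤ a) (ha : a < m) (hc : m < c) (hhi : c ≤ hi)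
    {p p' q : ℝ → ℝ} (hp : ∀ s, HasDerivAt p (p' s) s) (hp' : ∀ s, HasDerivAt p' (q s) s)
    (hq : Continuous q) : ∫ s in lo..hi, hat a m c s * q s = -secondDiff p a m c := by
  have hcont : Continuous fun s => hat a m c s * q s := continuous_hat.mul hq
  have hint : ∀ u v, IntervalIntegrable (fun s => hat a m c s * q s) MeasureTheory.volume u v :=
    fun u v => hcont.intervalIntegrable u v
  have h1 : ∫ s in lo..a, hat a m c s * q s = 0 := by
    rw [intervalIntegral.integral_congr (g := fun _ => (0 : ℝ)), intervalIntegral.integral_zero]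
    intro s hs
    rw [Set.uIcc_of_le hlo] at hs
    simp [hat_of_le hc hs.2]
  have h4 : ∫ s in c..hi, hat a m c s * q s = 0 := by
    rw [intervalIntegral.integral_congr (g := fun _ => (0 : ℝ)), intervalIntegral.integral_zero]
    intro s hs
    rw [Set.uIcc_of_le hhi] at hs
    simp [hat_of_ge ha hs.1]
  have h2 : ∫ s in a..m, hat a m c s * q s =
      (c - m) * ((m - a) * p' m - p m) - (c - m) * ((a - a) * p' a - p a) := by
    rw [intervalIntegral.integral_congr (g := fun s => (c - m) * (s - a) * q s)]
    · refine intervalIntegral.integral_eq_sub_of_hasDerivAt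
        (f := fun s => (c - m) * ((s - a) * p' s - p s)) (fun s _ => ?_)
        (Continuous.intervalIntegrable (by fun_prop) _ _)
      have := ((((hasDerivAt_id s).sub_const a).mul (hp' s)).sub (hp s)).const_mul (c - m)
      refine HasDerivAt.congr_deriv this ?_
      simp only [id]
      ring
    · intro s hs
      rw [Set.uIcc_of_le ha.le] at hs
      simp only [hat_eq_left ha hc hs.1 hs.2]
  have h3 : ∫ s in m..c, hat a m c s * q s =
      (m - a) * ((c - c) * p' c + p c) - (m - a) * ((c - m) * p' m + p m) := by
    rw [intervalIntegral.integral_congr (g := fun s => (m - a) * (c - s) * q s)]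
    · refine intervalIntegral.integral_eq_sub_of_hasDerivAt
        (f := fun s => (m - a) * ((c - s) * p' s + p s)) (fun s _ => ?_)
        (Continuous.intervalIntegrable (by fun_prop) _ _)
      have := ((((hasDerivAt_id s).const_sub c).mul (hp' s)).add (hp s)).const_mul (m - a)
      refine HasDerivAt.congr_deriv this ?_
      simp only [id]
      ring
    · intro s hs
      rw [Set.uIcc_of_le hc.le] at hs
      simp only [hat_eq_right ha hc hs.1 hs.2]
  rw [← intervalIntegral.integral_add_adjacent_intervals (hint lo a) (hint a hi),
    ← intervalIntegral.integral_add_adjacent_intervals (hint a m) (hint m hi),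
    ← intervalIntegral.integral_add_adjacent_intervals (hint m c) (hint c hi), h1, h2, h3, h4,
    secondDiff]
  ring

end Hat

/-- A finite set `B` of break points with extreme points `lo` and `hi`, together with nodes `x i`
strictly between `lo` and `hi`, which contain the other break points; `a i` and `c i` are the break
points that come directly before and after `x i`. The index order plays no role here; where it does,
`x` is assumed to be strictly monotone. -/
structure BreakSystem {ι : Type*} (B : Set ℝ) (lo hi : ℝ) (x a c : ι → ℝ) : Prop where
  lo_mem : lo ∈ B
  hi_mem : hi ∈ B
  lo_lt_hi : lo < hi
  cases : ∀ b ∈ B, b = lo ∨ b = hi ∨ ∃ i, x i = b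
  lo_lt : ∀ i, lo < x i
  lt_hi : ∀ i, x i < hi
  a_mem : ∀ i, a i ∈ B
  a_lt : ∀ i, a i < x i
  le_a : ∀ i, ∀ b ∈ B, b < x i → b ≤ a i
  c_mem : ∀ i, c i ∈ B
  lt_c : ∀ i, x i < c i
  c_le : ∀ i, ∀ b ∈ B, x i < b → c i ≤ b

namespace BreakSystem

variable {ι : Type*} {B : Set ℝ} {lo hi : ℝ} {x a c : ι → ℝ}

theorem finite [Finite ι] (hS : BreakSystem B lo hi x a c) : B.Finite := by
  refine ((Set.finite_range x).union (Set.toFinite {lo, hi})).subset fun b hb => ?_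
  rcases hS.cases b hb with rfl | rfl | ⟨i, rfl⟩ <;> simp

theorem lo_le_a (hS : BreakSystem B lo hi x a c) (i : ι) : lo ≤ a i :=
  hS.le_a i lo hS.lo_mem (hS.lo_lt i)

theorem c_le_hi (hS : BreakSystem B lo hi x a c) (i : ι) : c i ≤ hi :=
  hS.c_le i hi hS.hi_mem (hS.lt_hi i)

/-- Between two adjacent break points a hat function can only have a kink at its own node. -/
theorem hat_chord_eq (hS : BreakSystem B lo hi x a c) {b b' u v : ℝ}
    (hadj : ∀ β ∈ B, β ≤ b ∨ b' ≤ β) (hu : b ≤ u) (hv : v ≤ b') {s : ℝ} (hus : u < s) (hsv : s < v)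
    (i : ι) (hi : x i ≤ u ∨ v ≤ x i) :
    (v - u) * hat (a i) (x i) (c i) s =
      (v - s) * hat (a i) (x i) (c i) u + (s - u) * hat (a i) (x i) (c i) v := by
  have ha := hS.a_lt i
  have hc := hS.lt_c i
  rcases hi with hi | hi
  · rcases lt_or_ge b (c i) with h | h
    · have hcv : v ≤ c i := by
        rcases hadj _ (hS.c_mem i) with h1 | h1 <;> linarith
      rw [hat_eq_right ha hc (by linarith) (by linarith), hat_eq_right ha hc hi (by linarith),
        hat_eq_right ha hc (by linarith) hcv]
      ring
    · rw [hat_of_ge ha (by linarith), hat_of_ge ha (by linarith), hat_of_ge ha (by linarith)]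
      ring
  · rcases lt_or_ge (a i) b' with h | h
    · have hau : a i ≤ u := by
        rcases hadj _ (hS.a_mem i) with h1 | h1 <;> linarith
      rw [hat_eq_left ha hc (by linarith) (by linarith), hat_eq_left ha hc hau (by linarith),
        hat_eq_left ha hc (by linarith) hi]
      ring
    · rw [hat_of_le hc (by linarith), hat_of_le hc (by linarith), hat_of_le hc (by linarith)]
      ring

/-- Between two adjacent break points a hat function is strictly concave at its own node. -/
theorem hat_chord_lt (hS : BreakSystem B lo hi x a c) {b b' u v : ℝ}
    (hadj : ∀ β ∈ B, β ≤ b ∨ b' ≤ β) (hu : b ≤ u) (hv : v ≤ b') {s : ℝ} (hus : u < s) (hsv : s < v)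
    (i : ι) (hui : u < x i) (hiv : x i < v) :
    (v - s) * hat (a i) (x i) (c i) u + (s - u) * hat (a i) (x i) (c i) v <
      (v - u) * hat (a i) (x i) (c i) s := by
  have ha := hS.a_lt i
  have hc := hS.lt_c i
  have hau : a i ≤ u := by
    rcases hadj _ (hS.a_mem i) with h1 | h1 <;> linarith
  have hcv : v ≤ c i := by
    rcases hadj _ (hS.c_mem i) with h1 | h1 <;> linarith
  rw [hat_eq_left ha hc hau hui.le, hat_eq_right ha hc hiv.le hcv]
  have hac : 0 < c i - a i := by linarith
  rcases le_total s (x i) with h | h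
  · rw [hat_eq_left ha hc (by linarith) h]
    have : 0 < (s - u) * (v - x i) * (c i - a i) := by
      have := sub_pos.2 hus
      have := sub_pos.2 hiv
      positivity
    nlinarith
  · rw [hat_eq_right ha hc h (by linarith)]
    have : 0 < (v - s) * (x i - u) * (c i - a i) := by
      have := sub_pos.2 hsv
      have := sub_pos.2 hui
      positivity
    nlinarith

end BreakSystem

section Spline

variable {ι : Type*} [Fintype ι] {B : Set ℝ} {lo hi : ℝ} {x a c : ι → ℝ}

/-- The combination of the hat functions of a break system with coefficients `y`. -/
noncomputable def spline (x a c y : ι → ℝ) (s : ℝ) : ℝ :=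
  ∑ i, y i * hat (a i) (x i) (c i) s

theorem continuous_spline (y : ι → ℝ) : Continuous (spline x a c y) :=
  continuous_finsetSum _ fun _ _ => continuous_const.mul continuous_hat

namespace BreakSystem

theorem spline_eq_zero_of_le (hS : BreakSystem B lo hi x a c) (y : ι → ℝ) {s : ℝ} (hs : s ≤ lo) :
    spline x a c y s = 0 :=
  Finset.sum_eq_zero fun i _ => by
    rw [hat_of_le (hS.lt_c i) (hs.trans (hS.lo_le_a i)), mul_zero]

theorem spline_eq_zero_of_ge (hS : BreakSystem B lo hi x a c) (y : ι → ℝ) {s : ℝ} (hs : hi ≤ s) :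
    spline x a c y s = 0 :=
  Finset.sum_eq_zero fun i _ => by
    rw [hat_of_ge (hS.a_lt i) ((hS.c_le_hi i).trans hs), mul_zero]

theorem spline_at_break [LinearOrder ι] (hS : BreakSystem B lo hi x a c) (hx : StrictMono x)
    (y : ι → ℝ) (i : ι) (hi : x i ∈ B) :
    spline x a c y (x i) = y i * ((c i - x i) * (x i - a i)) := by
  rw [spline, Finset.sum_eq_single i]
  · rw [hat_eq_left (hS.a_lt i) (hS.lt_c i) (hS.a_lt i).le le_rfl]
  · intro j _ hj
    rcases lt_or_gt_of_ne hj with h | h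
    · rw [hat_of_ge (hS.a_lt j) (hS.c_le j _ hi (hx h)), mul_zero]
    · rw [hat_of_le (hS.lt_c j) (hS.le_a j _ hi (hx h)), mul_zero]
  · simp

/-- Variation diminishing, local form: where a spline is positive between two arguments at which it
is not, some node in between has a positive coefficient, for otherwise the spline would be convex
around `s`. The factor `ε` allows for both signs. -/
theorem exists_node_pos [LinearOrder ι] (hS : BreakSystem B lo hi x a c) (hx : StrictMono x)
    (y : ι → ℝ) (ε : ℝ) {u s v : ℝ} (hus : u < s) (hsv : s < v) (hu : ε * spline x a c y u ≤ 0)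
    (hv : ε * spline x a c y v ≤ 0) (hs : 0 < ε * spline x a c y s) :
    ∃ i, u < x i ∧ x i < v ∧ 0 < ε * y i := by
  by_contra! hcon
  have hlos : lo < s := by
    by_contra! h
    simp [hS.spline_eq_zero_of_le y h] at hs
  have hshi : s < hi := by
    by_contra! h
    simp [hS.spline_eq_zero_of_ge y h] at hs
  have hbreak : ∀ β ∈ B, u < β → β < v → ε * spline x a c y β ≤ 0 := by
    intro β hβ h1 h2
    rcases hS.cases β hβ with rfl | rfl | ⟨i, rfl⟩
    · rw [hS.spline_eq_zero_of_le y le_rfl, mul_zero]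
    · rw [hS.spline_eq_zero_of_ge y le_rfl, mul_zero]
    · rw [hS.spline_at_break hx y i hβ, ← mul_assoc]
      exact mul_nonpos_of_nonpos_of_nonneg (hcon i h1 h2)
        (mul_nonneg (sub_pos.2 (hS.lt_c i)).le (sub_pos.2 (hS.a_lt i)).le)
  have hsB : s ∉ B := fun h => absurd hs (not_lt.2 (hbreak s h hus hsv))
  obtain ⟨b, ⟨hbB, hbs⟩, hbmax⟩ := Set.exists_max_image {β | β ∈ B ∧ β < s} id
    (hS.finite.subset fun _ h => h.1) ⟨lo, hS.lo_mem, hlos⟩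
  obtain ⟨b', ⟨hbB', hbs'⟩, hbmin⟩ := Set.exists_min_image {β | β ∈ B ∧ s < β} id
    (hS.finite.subset fun _ h => h.1) ⟨hi, hS.hi_mem, hshi⟩
  have hadj : ∀ β ∈ B, β ≤ b ∨ b' ≤ β := by
    intro β hβ
    rcases lt_trichotomy β s with h | rfl | h
    · exact Or.inl (hbmax β ⟨hβ, h⟩)
    · exact absurd hβ hsB
    · exact Or.inr (hbmin β ⟨hβ, h⟩)
  have hu' : ε * spline x a c y (max u b) ≤ 0 := by
    rcases le_total b u with h | h
    · rwa [max_eq_left h]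
    · rw [max_eq_right h]
      rcases h.eq_or_lt with rfl | h
      · exact hu
      · exact hbreak b hbB h (by linarith)
  have hv' : ε * spline x a c y (min v b') ≤ 0 := by
    rcases le_total v b' with h | h
    · rwa [min_eq_left h]
    · rw [min_eq_right h]
      rcases h.eq_or_lt with rfl | h
      · exact hv
      · exact hbreak b' hbB' (by linarith) h
  have h1 : max u b < s := max_lt hus hbs
  have h2 : s < min v b' := lt_min hsv hbs'
  have hchord : (min v b' - max u b) * (ε * spline x a c y s) ≤
      (min v b' - s) * (ε * spline x a c y (max u b)) +
        (s - max u b) * (ε * spline x a c y (min v b')) := by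
    simp only [spline, Finset.mul_sum]
    rw [← Finset.sum_add_distrib]
    refine Finset.sum_le_sum fun i _ => ?_
    by_cases hi : x i ≤ max u b ∨ min v b' ≤ x i
    · have := hS.hat_chord_eq hadj (le_max_right u b) (min_le_right v b') h1 h2 i hi
      linear_combination (ε * y i) * this
    · push Not at hi
      have h3 := hS.hat_chord_lt hadj (le_max_right u b) (min_le_right v b') h1 h2 i
        hi.1 hi.2
      have h4 := hcon i ((le_max_left _ _).trans_lt hi.1) (hi.2.trans_le (min_le_left _ _))
      nlinarith
  have h3 : 0 < (min v b' - max u b) * (ε * spline x a c y s) :=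
    mul_pos (by linarith) hs
  have h4 := mul_nonneg_of_nonpos_of_nonpos (neg_nonpos.2 (sub_pos.2 h2).le) hu'
  have h5 := mul_nonneg_of_nonpos_of_nonpos (neg_nonpos.2 (sub_pos.2 h1).le) hv'
  linarith

/-- Variation diminishing: a spline alternates at most as often as its coefficients. -/
theorem exists_chain_of_spline [LinearOrder ι] (hS : BreakSystem B lo hi x a c)
    (hx : StrictMono x) (y : ι → ℝ) (l : List ℝ) :
    ∀ u s : ℝ, u < s → spline x a c y u = 0 → spline x a c y s ≠ 0 →
      ((s :: l).IsChain fun r r' => r < r' ∧ spline x a c y r * spline x a c y r' < 0) →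
      ∃ i l', l'.length = l.length ∧ u < x i ∧ 0 < spline x a c y s * y i ∧
        (i :: l').IsChain fun j j' => j < j' ∧ y j * y j' < 0 := by
  induction l with
  | nil =>
    intro u s hus hu hs _
    have hshi : s < hi := by
      by_contra! h
      exact hs (hS.spline_eq_zero_of_ge y h)
    obtain ⟨i, hi, -, hy⟩ := hS.exists_node_pos hx y (spline x a c y s) hus hshi (by simp [hu])
      (by simp [hS.spline_eq_zero_of_ge y le_rfl]) (mul_self_pos.2 hs)
    exact ⟨i, [], rfl, hi, hy, by simp⟩
  | cons r l ih =>
    intro u s hus hu hs hc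
    obtain ⟨⟨hsr, hneg⟩, hc'⟩ := List.isChain_cons_cons.1 hc
    have hr : spline x a c y r ≠ 0 := right_ne_zero_of_mul hneg.ne
    obtain ⟨v, ⟨hsv, hvr⟩, hv⟩ : ∃ v ∈ Set.Icc s r, spline x a c y v = 0 := by
      rcases mul_neg_iff.1 hneg with ⟨h1, h2⟩ | ⟨h1, h2⟩
      · exact intermediate_value_Icc' hsr.le (continuous_spline y).continuousOn ⟨h2.le, h1.le⟩
      · exact intermediate_value_Icc hsr.le (continuous_spline y).continuousOn ⟨h1.le, h2.le⟩
    have hsv' : s < v := lt_of_le_of_ne hsv fun h => hs (h ▸ hv)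
    have hvr' : v < r := lt_of_le_of_ne hvr fun h => hr (h ▸ hv)
    obtain ⟨i, hui, hiv, hy⟩ := hS.exists_node_pos hx y (spline x a c y s) hus hsv' (by simp [hu])
      (by simp [hv]) (mul_self_pos.2 hs)
    obtain ⟨j, l', hlen, hvj, hyj, hl'⟩ := ih v r hvr' hv hr hc'
    refine ⟨i, j :: l', by simp [hlen], hui, hy, List.isChain_cons_cons.2 ⟨⟨?_, ?_⟩, hl'⟩⟩
    · exact hx.lt_iff_lt.1 (hiv.trans hvj)
    · by_contra! h
      have h1 := mul_pos hy hyj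
      nlinarith [mul_nonneg_of_nonpos_of_nonpos hneg.le (neg_nonpos.2 h)]

theorem hasAlternation_of_spline [LinearOrder ι] (hS : BreakSystem B lo hi x a c)
    (hx : StrictMono x) (y : ι → ℝ) {k : ℕ} (hk : 2 ≤ k)
    (h : HasAlternation (spline x a c y) k) : HasAlternation y k := by
  obtain ⟨l, hlen, hl⟩ := h
  cases l with
  | nil => simp at hlen; omega
  | cons s l =>
    have hs := ne_zero_of_mem_alternation (by omega) hl s (by simp)
    have hlos : lo < s := by
      by_contra! h
      exact hs (hS.spline_eq_zero_of_le y h)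
    obtain ⟨i, l', hlen', -, -, hl'⟩ :=
      hS.exists_chain_of_spline hx y l lo s hlos (hS.spline_eq_zero_of_le y le_rfl) hs hl
    exact ⟨i :: l', by simpa [hlen'] using hlen, hl'⟩

/-- The hat functions are linearly independent. -/
theorem eq_zero_of_spline_eq_zero [LinearOrder ι] (hS : BreakSystem B lo hi x a c)
    (hx : StrictMono x) (y : ι → ℝ) (h : ∀ s, spline x a c y s = 0) : y = 0 := by
  funext i
  by_cases hi : x i ∈ B
  · have h1 := hS.spline_at_break hx y i hi
    rw [h] at h1
    exact (mul_eq_zero.1 h1.symm).resolve_right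
      (mul_pos (sub_pos.2 (hS.lt_c i)) (sub_pos.2 (hS.a_lt i))).ne'
  · -- a neighbourhood of `x i` without break points and other nodes
    have hfin : (B ∪ x '' {j | j ≠ i}).Finite := hS.finite.union (Set.toFinite _)
    have hnot : x i ∈ (B ∪ x '' {j | j ≠ i})ᶜ := by
      rintro (h | ⟨j, hj, hji⟩)
      · exact hi h
      · exact hj (hx.injective hji)
    obtain ⟨δ, hδ, hball⟩ := Metric.isOpen_iff.1 hfin.isClosed.isOpen_compl _ hnot
    have hfar : ∀ r ∈ B ∪ x '' {j | j ≠ i}, r ≤ x i - δ / 2 ∨ x i + δ / 2 ≤ r := by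
      intro r hr
      by_contra! hcon
      have hrb : r ∈ Metric.ball (x i) δ := by
        rw [Metric.mem_ball, Real.dist_eq, abs_lt]
        constructor <;> linarith
      exact hball hrb hr
    have hadj : ∀ β ∈ B, β ≤ a i ∨ c i ≤ β := by
      intro β hβ
      rcases lt_trichotomy β (x i) with h | rfl | h
      · exact Or.inl (hS.le_a i β hβ h)
      · exact absurd hβ hi
      · exact Or.inr (hS.c_le i β hβ h)
    have hau : a i ≤ x i - δ / 2 := by
      rcases hfar _ (Or.inl (hS.a_mem i)) with h | h
      · exact h
      · linarith [hS.a_lt i]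
    have hvc : x i + δ / 2 ≤ c i := by
      rcases hfar _ (Or.inl (hS.c_mem i)) with h | h
      · linarith [hS.lt_c i]
      · exact h
    set u := x i - δ / 2 with hu
    set v := x i + δ / 2 with hv
    have h1 : u < x i := by linarith
    have h2 : x i < v := by linarith
    have hlt := hS.hat_chord_lt hadj hau hvc h1 h2 i h1 h2
    have hsum : (v - u) * spline x a c y (x i) - (v - x i) * spline x a c y u -
        (x i - u) * spline x a c y v =
        y i * ((v - u) * hat (a i) (x i) (c i) (x i) - (v - x i) * hat (a i) (x i) (c i) u -
          (x i - u) * hat (a i) (x i) (c i) v) := by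
      simp only [spline, Finset.mul_sum]
      rw [← Finset.sum_sub_distrib, ← Finset.sum_sub_distrib, Finset.sum_eq_single i]
      · ring
      · intro j _ hj
        have := hS.hat_chord_eq hadj hau hvc h1 h2 j
          (hfar _ (Or.inr ⟨j, hj, rfl⟩))
        linear_combination (y j) * this
      · simp
    rw [h, h, h] at hsum
    simp only [mul_zero, sub_zero] at hsum
    exact (mul_eq_zero.1 hsum.symm).resolve_right (by linarith)

open Polynomial in
/-- A nontrivial linear relation between the second differences at the nodes of all polynomials of
degree at most `e + 2` alternates `e + 2` times: otherwise a polynomial of degree at most `e` with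
the signs of the spline of the relation would be orthogonal to this spline. -/
theorem hasAlternation_of_relation [LinearOrder ι] (hS : BreakSystem B lo hi x a c)
    (hx : StrictMono x) (e : ℕ) (y : ι → ℝ) (hy : y ≠ 0)
    (h : ∀ p : ℝ[X], p.natDegree ≤ e + 2 →
      ∑ i, y i * secondDiff (fun s => p.eval s) (a i) (x i) (c i) = 0) :
    HasAlternation y (e + 2) := by
  by_contra hcon
  obtain ⟨q, hq0, hqd, hq⟩ := exists_polynomial_mul_nonneg (a := lo) e (spline x a c y)
    (fun s hs => by
      by_contra! hlt
      exact hs (hS.spline_eq_zero_of_le y hlt.le))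
    (fun halt => hcon (hS.hasAlternation_of_spline hx y (by omega) halt))
  obtain ⟨p', hp', hpd'⟩ := exists_polynomial_derivative_eq q
  obtain ⟨p, hp, hpd⟩ := exists_polynomial_derivative_eq p'
  have hint : ∫ s in lo..hi, q.eval s * spline x a c y s = 0 := by
    have h1 : ∀ s, q.eval s * spline x a c y s =
        ∑ i, y i * (hat (a i) (x i) (c i) s * q.eval s) := by
      intro s
      rw [spline, Finset.mul_sum]
      exact Finset.sum_congr rfl fun i _ => by ring
    simp only [h1]
    rw [intervalIntegral.integral_finsetSum (f := fun i s => y i * (hat (a i) (x i) (c i) s *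
      q.eval s)) fun i _ => Continuous.intervalIntegrable
        (continuous_const.mul (continuous_hat.mul q.continuous)) lo hi]
    have h2 : ∀ i, ∫ s in lo..hi, y i * (hat (a i) (x i) (c i) s * q.eval s) =
        -(y i * secondDiff (fun s => p.eval s) (a i) (x i) (c i)) := by
      intro i
      rw [intervalIntegral.integral_const_mul, integral_hat_mul (hS.lo_le_a i) (hS.a_lt i)
        (hS.lt_c i) (hS.c_le_hi i) (p := fun s => p.eval s) (p' := fun s => p'.eval s)
        (fun s => hp ▸ p.hasDerivAt s) (fun s => hp' ▸ p'.hasDerivAt s) q.continuous, mul_neg]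
    rw [Finset.sum_congr rfl fun i _ => h2 i, Finset.sum_neg_distrib, h p (by omega), neg_zero]
  have hcont : Continuous fun s => q.eval s * spline x a c y s :=
    q.continuous.mul (continuous_spline y)
  have hzero : ∀ s, q.eval s * spline x a c y s = 0 := by
    intro s
    by_cases hs : s ∈ Set.Icc lo hi
    · by_contra hne
      exact (intervalIntegral.integral_pos hS.lo_lt_hi hcont.continuousOn (fun r _ => hq r)
        ⟨s, hs, lt_of_le_of_ne (hq s) (Ne.symm hne)⟩).ne' hint
    · rw [Set.mem_Icc, not_and_or, not_le, not_le] at hs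
      rcases hs with hs | hs
      · rw [hS.spline_eq_zero_of_le y hs.le, mul_zero]
      · rw [hS.spline_eq_zero_of_ge y hs.le, mul_zero]
  refine hy (hS.eq_zero_of_spline_eq_zero hx y fun s => ?_)
  by_contra hs
  -- the spline is nonzero near `s`, so that `q` would have infinitely many zeros
  have hnhds : {r | spline x a c y r ≠ 0} ∈ nhds s :=
    (continuous_spline y).continuousAt.eventually_ne hs
  exact hq0 (q.eq_zero_of_infinite_isRoot ((infinite_of_mem_nhds s hnhds).mono fun r hr =>
    (mul_eq_zero.1 (hzero r)).resolve_right hr))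

end BreakSystem

end Spline

/-! ### Sign vectors of second differences and of values along the moment curve -/

theorem secondDiff_add_affine (g : ℝ → ℝ) (α β a m c : ℝ) :
    secondDiff (fun s => g s + (α + β * s)) a m c = secondDiff g a m c := by
  simp only [secondDiff]
  ring

/-- The signs of the second differences at the nodes of a break system that are realized by
functionals along the moment curve. They do not depend on the break system. -/
theorem exists_sign_secondDiff_iff {ι : Type*} [Fintype ι] [LinearOrder ι] {B : Set ℝ} {lo hi : ℝ}
    {x a c : ι → ℝ} (hS : BreakSystem B lo hi x a c) (hx : StrictMono x) {d : ℕ} (hd : 2 ≤ d)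
    (μ : ι → SignType) :
    (∃ f : (Fin d → ℝ) →ₗ[ℝ] ℝ,
      ∀ i, SignType.sign (secondDiff (fun s => f (moment d s)) (a i) (x i) (c i)) = μ i) ↔
      μ = 0 ∨ ¬ HasWeakAlternation μ d := by
  obtain ⟨e, rfl⟩ : ∃ e, d = e + 2 := ⟨d - 2, by omega⟩
  let D : (Fin (e + 1) → ℝ) →ₗ[ℝ] (ι → ℝ) :=
    { toFun := fun w i => secondDiff (fun s => ∑ k, w k * s ^ ((k : ℕ) + 2)) (a i) (x i) (c i)
      map_add' := fun w w' => by
        funext i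
        simp only [secondDiff, Pi.add_apply, add_mul, Finset.sum_add_distrib]
        ring
      map_smul' := fun r w => by
        funext i
        simp only [secondDiff, Pi.smul_apply, smul_eq_mul, mul_assoc, ← Finset.mul_sum,
          RingHom.id_apply]
        ring }
  have hD : ∀ w i, D w i =
      secondDiff (fun s => ∑ k, w k * s ^ ((k : ℕ) + 2)) (a i) (x i) (c i) := fun _ _ => rfl
  rw [← exists_sign_eq_iff D (e := e) (by simp) (fun y hy hrel =>
    hS.hasAlternation_of_relation hx e y hy fun p hp => ?_) μ]
  · constructor
    · rintro ⟨f, hf⟩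
      refine ⟨fun k => f (Pi.single k.succ 1), fun i => ?_⟩
      rw [← hf i, hD, ← secondDiff_add_affine _ 0 (f (Pi.single 0 1))]
      congr 2
      funext s
      have h1 : moment (e + 2) s =
          ∑ k : Fin (e + 2), s ^ ((k : ℕ) + 1) • (Pi.single k 1 : Fin (e + 2) → ℝ) := by
        conv_lhs => rw [← Finset.univ_sum_single (moment (e + 2) s)]
        refine Finset.sum_congr rfl fun k _ => ?_
        rw [← Pi.single_smul, smul_eq_mul, mul_one]
        rfl
      rw [h1, map_sum, Fin.sum_univ_succ (n := e + 1), add_comm]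
      simp only [map_smul, smul_eq_mul, Fin.val_zero, Fin.val_succ, zero_add, pow_one, add_assoc,
        one_add_one_eq_two, mul_comm]
    · rintro ⟨w, hw⟩
      refine ⟨∑ k, w k • LinearMap.proj k.succ, fun i => ?_⟩
      rw [← hw i, hD]
      simp [moment, LinearMap.sum_apply, add_assoc]
  · have h1 := hrel fun k => p.coeff (k + 2)
    rw [← h1]
    refine Finset.sum_congr rfl fun i _ => ?_
    rw [hD]
    conv_rhs => rw [← secondDiff_add_affine _ (p.coeff 0) (p.coeff 1)]
    congr 2
    funext s
    rw [p.eval_eq_sum_range' (n := e + 3) (by omega), Finset.sum_range_succ',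
      Finset.sum_range_succ', Finset.sum_range]
    simp only [zero_add, pow_zero, pow_one, mul_one, add_assoc]
    norm_num
    ring

/-- The signs of the values of affine functionals at points of the moment curve. They do not depend
on the parameters of the points. -/
theorem exists_sign_affine_iff {n : ℕ} {t : Fin n → ℝ} (ht : StrictMono t) (d : ℕ)
    (μ : Fin n → SignType) :
    (∃ (f : (Fin d → ℝ) →ₗ[ℝ] ℝ) (M : ℝ), ∀ i, SignType.sign (f (moment d (t i)) - M) = μ i) ↔
      μ = 0 ∨ ¬ HasWeakAlternation μ (d + 2) := by
  let D : ((Fin d → ℝ) × ℝ) →ₗ[ℝ] (Fin n → ℝ) :=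
    { toFun := fun w i => ∑ k, w.1 k * moment d (t i) k - w.2
      map_add' := fun w w' => by
        funext i
        simp only [Prod.fst_add, Prod.snd_add, Pi.add_apply, add_mul, Finset.sum_add_distrib]
        ring
      map_smul' := fun r w => by
        funext i
        simp only [Prod.smul_fst, Prod.smul_snd, Pi.smul_apply, smul_eq_mul, mul_assoc,
          ← Finset.mul_sum, RingHom.id_apply]
        ring }
  have hD : ∀ w i, D w i = ∑ k, w.1 k * moment d (t i) k - w.2 := fun _ _ => rfl
  rw [← exists_sign_eq_iff D (e := d) (by simp) (fun y hy hrel =>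
    hasAlternation_of_sum_eval_eq_zero ht d y hy fun p hp => ?_) μ]
  · constructor
    · rintro ⟨f, M, hf⟩
      refine ⟨(fun k => f (Pi.single k 1), M), fun i => ?_⟩
      rw [← hf i, hD]
      congr 2
      conv_rhs => rw [← Finset.univ_sum_single (moment d (t i))]
      rw [map_sum]
      refine Finset.sum_congr rfl fun k _ => ?_
      have : (Pi.single k (moment d (t i) k) : Fin d → ℝ) = moment d (t i) k • Pi.single k 1 := by
        rw [← Pi.single_smul, smul_eq_mul, mul_one]
      rw [this, map_smul, smul_eq_mul, mul_comm]
    · rintro ⟨w, hw⟩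
      refine ⟨∑ k, w.1 k • LinearMap.proj k, w.2, fun i => ?_⟩
      rw [← hw i, hD]
      simp [LinearMap.sum_apply]
  · have h1 := hrel (fun k => p.coeff (k + 1), -p.coeff 0)
    rw [← h1]
    refine Finset.sum_congr rfl fun i _ => ?_
    rw [hD, p.eval_eq_sum_range' (n := d + 1) (by omega), Finset.sum_range_succ', Finset.sum_range]
    simp [moment]

/-! ### Convexity of the lower hull from local conditions -/

theorem secondDiff_neg (g : ℝ → ℝ) (a m c : ℝ) :
    secondDiff (fun s => g (-s)) (-c) (-m) (-a) = secondDiff g a m c := by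
  simp only [secondDiff, neg_neg]
  ring

namespace BreakSystem

variable {ι : Type*} {B : Set ℝ} {lo hi : ℝ} {x a c : ι → ℝ}

/-- The mirror image of a break system. -/
theorem neg (hS : BreakSystem B lo hi x a c) :
    BreakSystem {b | -b ∈ B} (-hi) (-lo) (fun i => -x i) (fun i => -c i) (fun i => -a i) where
  lo_mem := by simpa using hS.hi_mem
  hi_mem := by simpa using hS.lo_mem
  lo_lt_hi := neg_lt_neg hS.lo_lt_hi
  cases b hb := by
    rcases hS.cases _ hb with h | h | ⟨i, h⟩
    · exact Or.inr (Or.inl (by linarith))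
    · exact Or.inl (by linarith)
    · exact Or.inr (Or.inr ⟨i, by linarith⟩)
  lo_lt i := neg_lt_neg (hS.lt_hi i)
  lt_hi i := neg_lt_neg (hS.lo_lt i)
  a_mem i := by simpa using hS.c_mem i
  a_lt i := neg_lt_neg (hS.lt_c i)
  le_a i b hb h := by have := hS.c_le i _ hb (by linarith); linarith
  c_mem i := by simpa using hS.a_mem i
  lt_c i := neg_lt_neg (hS.a_lt i)
  c_le i b hb h := by have := hS.le_a i _ hb (by linarith); linarith

/-- If the piecewise linear interpolation of `g` at the break points is convex and lies below `g` at
the nodes, then a function vanishing at two adjacent break points is positive to the right of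
them. -/
theorem pos_of_gt [Finite ι] (hS : BreakSystem B lo hi x a c) {g : ℝ → ℝ}
    (hconv : ∀ i, x i ∈ B → secondDiff g (a i) (x i) (c i) < 0)
    (habove : ∀ i, x i ∉ B → 0 ≤ secondDiff g (a i) (x i) (c i))
    {b b' : ℝ} (hb : b ∈ B) (hb' : b' ∈ B) (hbb' : b < b') (hadj : ∀ β ∈ B, β ≤ b ∨ b' ≤ β)
    (hgb : g b = 0) (hgb' : g b' = 0) :
    (∀ β ∈ B, b' < β → 0 < g β) ∧ ∀ i, b' < x i → 0 < g (x i) := by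
  have hlob : lo ≤ b := by
    rcases hS.cases b hb with rfl | rfl | ⟨i, rfl⟩
    · exact le_rfl
    · rcases hS.cases b' hb' with rfl | rfl | ⟨i, rfl⟩
      · exact hS.lo_lt_hi.le
      · exact absurd hbb' (lt_irrefl _)
      · exact absurd (hS.lt_hi i) (not_lt.2 hbb'.le)
    · exact (hS.lo_lt i).le
  have hnode : ∀ β ∈ B, b' ≤ β → β < hi → ∃ i, x i = β := by
    intro β hβ h1 h2
    rcases hS.cases β hβ with rfl | rfl | h
    · linarith
    · exact absurd h2 (lt_irrefl _)
    · exact h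
  have key : ∀ i, x i ∈ B → b' ≤ x i → (b' < x i → 0 < g (x i)) ∧ g (x i) < g (c i) := by
    have : IsTrans ι fun i j => x i < x j := ⟨fun _ _ _ => lt_trans⟩
    have : Std.Irrefl fun i j : ι => x i < x j := ⟨fun _ => lt_irrefl _⟩
    intro i
    induction i using (Finite.wellFounded_of_trans_of_irrefl fun i j : ι => x i < x j).induction with
    | _ i ih =>
      intro hi hbi
      have ha := hS.a_lt i
      have hc := hS.lt_c i
      have h1 := hconv i hi
      rw [secondDiff] at h1
      rcases hbi.eq_or_lt with heq | hlt
      · have hai : a i = b := by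
          have h2 := hS.le_a i b hb (heq ▸ hbb')
          rcases hadj _ (hS.a_mem i) with h3 | h3
          · exact le_antisymm h3 h2
          · linarith
        refine ⟨fun h => absurd heq h.ne, ?_⟩
        rw [hai, ← heq, hgb, hgb'] at h1
        rw [← heq, hgb']
        have h2 : 0 < b' - b := by linarith
        by_contra! h3
        nlinarith
      · have hba : b' ≤ a i := hS.le_a i b' hb' hlt
        obtain ⟨j, hj⟩ := hnode _ (hS.a_mem i) hba (ha.trans (hS.lt_hi i))
        have hcj : c j = x i := by
          refine le_antisymm (hS.c_le j _ hi (hj ▸ ha)) ?_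
          by_contra! h2
          have := hS.le_a i _ (hS.c_mem j) h2
          linarith [hS.lt_c j]
        obtain ⟨h2, h3⟩ := ih j (hj ▸ ha) (hj ▸ hS.a_mem i) (hj ▸ hba)
        rw [hcj] at h3
        have h4 : 0 ≤ g (x j) := by
          rcases hba.eq_or_lt with h5 | h5
          · rw [hj, ← h5, hgb']
          · exact (h2 (hj ▸ h5)).le
        refine ⟨fun _ => by linarith, ?_⟩
        rw [← hj] at h1 ha
        by_contra! h5
        nlinarith [mul_pos (sub_pos.2 hc) (sub_pos.2 h3),
          mul_nonneg (sub_pos.2 ha).le (sub_nonneg.2 h5)]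
  have hbreak : ∀ β ∈ B, b' < β → 0 < g β := by
    intro β hβ hlt
    rcases hS.cases β hβ with rfl | rfl | ⟨i, rfl⟩
    · linarith
    · obtain ⟨γ, ⟨hγB, hγ⟩, hmax⟩ := Set.exists_max_image {γ | γ ∈ B ∧ γ < β} id
        (hS.finite.subset fun _ h => h.1) ⟨b', hb', hlt⟩
      have hbγ : b' ≤ γ := hmax b' ⟨hb', hlt⟩
      obtain ⟨j, rfl⟩ := hnode γ hγB hbγ hγ
      have hcj : c j = β := by
        refine le_antisymm (hS.c_le_hi j) ?_
        by_contra! h2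
        have : c j ≤ x j := hmax _ ⟨hS.c_mem j, h2⟩
        linarith [hS.lt_c j]
      obtain ⟨h2, h3⟩ := key j hγB hbγ
      rw [hcj] at h3
      rcases hbγ.eq_or_lt with h5 | h5
      · rwa [← h5, hgb'] at h3
      · exact (h2 h5).trans h3
    · exact (key i hβ hlt.le).1 hlt
  refine ⟨hbreak, fun i hlt => ?_⟩
  by_cases hi : x i ∈ B
  · exact hbreak _ hi hlt
  · have h1 := habove i hi
    rw [secondDiff] at h1
    have ha := hS.a_lt i
    have hc := hS.lt_c i
    have h2 : 0 ≤ g (a i) := by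
      rcases (hS.le_a i b' hb' hlt).eq_or_lt with h3 | h3
      · rw [← h3, hgb']
      · exact (hbreak _ (hS.a_mem i) h3).le
    have h3 := hbreak _ (hS.c_mem i) (hlt.trans hc)
    by_contra! h4
    nlinarith [mul_pos (sub_pos.2 ha) h3, mul_nonneg (sub_pos.2 hc).le h2,
      mul_nonneg (sub_pos.2 (ha.trans hc)).le (neg_nonneg.2 h4)]

/-- The mirror image of `BreakSystem.pos_of_gt`. -/
theorem pos_of_lt [Finite ι] (hS : BreakSystem B lo hi x a c) {g : ℝ → ℝ}
    (hconv : ∀ i, x i ∈ B → secondDiff g (a i) (x i) (c i) < 0)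
    (habove : ∀ i, x i ∉ B → 0 ≤ secondDiff g (a i) (x i) (c i))
    {b b' : ℝ} (hb : b ∈ B) (hb' : b' ∈ B) (hbb' : b < b') (hadj : ∀ β ∈ B, β ≤ b ∨ b' ≤ β)
    (hgb : g b = 0) (hgb' : g b' = 0) :
    (∀ β ∈ B, β < b → 0 < g β) ∧ ∀ i, x i < b → 0 < g (x i) := by
  obtain ⟨h1, h2⟩ := hS.neg.pos_of_gt (g := fun s => g (-s)) (b := -b') (b' := -b)
    (fun i hi => by rw [secondDiff_neg]; exact hconv i (by simpa using hi))
    (fun i hi => by rw [secondDiff_neg]; exact habove i (by simpa using hi))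
    (by simpa using hb') (by simpa using hb) (neg_lt_neg hbb')
    (fun β hβ => by rcases hadj _ hβ with h | h <;> [right; left] <;> linarith)
    (by simpa using hgb') (by simpa using hgb)
  refine ⟨fun β hβ h => ?_, fun i h => ?_⟩
  · simpa using h1 (-β) (by simpa using hβ) (neg_lt_neg h)
  · simpa using h2 i (neg_lt_neg h)

end BreakSystem

/-! ### Faces of convex hulls and of cyclic polytopes -/

section Hull

variable {E : Type*} [AddCommGroup E] [Module ℝ E]

/-- Where a functional attains its minimum over the hull of `s`, the point lies in the hull of the
points of `s` at which the minimum is attained. -/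
theorem le_and_mem_convexHull {s : Set E} {f : E →ₗ[ℝ] ℝ} {M : ℝ} (h : ∀ y ∈ s, M ≤ f y) {x : E}
    (hx : x ∈ convexHull ℝ s) : M ≤ f x ∧ (f x = M → x ∈ convexHull ℝ {y | y ∈ s ∧ f y = M}) := by
  have hsub : convexHull ℝ s ⊆
      {x | M ≤ f x ∧ (f x = M → x ∈ convexHull ℝ {y | y ∈ s ∧ f y = M})} := by
    refine convexHull_min (fun y hy => ⟨h y hy, fun hM => subset_convexHull ℝ _ ⟨hy, hM⟩⟩) ?_
    rintro y ⟨hy, hy'⟩ z ⟨hz, hz'⟩ α β hα hβ hαβ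
    have hval : f (α • y + β • z) - M = α * (f y - M) + β * (f z - M) := by
      rw [map_add, map_smul, map_smul, smul_eq_mul, smul_eq_mul]
      linear_combination M * hαβ
    have h1 : 0 ≤ α * (f y - M) := mul_nonneg hα (sub_nonneg.2 hy)
    have h2 : 0 ≤ β * (f z - M) := mul_nonneg hβ (sub_nonneg.2 hz)
    refine ⟨by linarith, fun heq => ?_⟩
    have h3 : α * (f y - M) = 0 := by linarith
    have h4 : β * (f z - M) = 0 := by linarith
    rcases mul_eq_zero.1 h3 with rfl | h5
    · obtain rfl : β = 1 := by linarith
      simpa using hz' (by linarith)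
    rcases mul_eq_zero.1 h4 with rfl | h6
    · obtain rfl : α = 1 := by linarith
      simpa using hy' (by linarith)
    exact convex_convexHull ℝ _ (hy' (by linarith)) (hz' (by linarith)) hα hβ hαβ
  exact hsub hx

end Hull

section Cyclic

variable {n d : ℕ} {t : Fin n → ℝ}

theorem moment_mem (t : Fin n → ℝ) (i : Fin n) : moment d (t i) ∈ cyclicPolytope d t :=
  subset_convexHull ℝ _ ⟨i, rfl⟩

theorem convex_cyclicPolytope : Convex ℝ (cyclicPolytope d t) :=
  convex_convexHull ℝ _

/-- Faces are described by the minimum of a functional rather than its maximum, so that the functional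
is nonnegative after subtracting `M`. -/
theorem isFace_iff {F : Set (Fin d → ℝ)} :
    IsFace (cyclicPolytope d t) F ↔ ∃ (f : (Fin d → ℝ) →ₗ[ℝ] ℝ) (M : ℝ),
      (∀ i, M ≤ f (moment d (t i))) ∧ (∃ i, f (moment d (t i)) = M) ∧
        F = {x | x ∈ cyclicPolytope d t ∧ f x = M} := by
  constructor
  · rintro ⟨⟨x₀, hx₀⟩, hexp⟩
    obtain ⟨φ, rfl⟩ := hexp ⟨x₀, hx₀⟩
    have hle : ∀ i, -φ x₀ ≤ (-φ : (Fin d → ℝ) →ₗ[ℝ] ℝ) (moment d (t i)) := fun i =>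
      neg_le_neg (hx₀.2 _ (moment_mem t i))
    refine ⟨(-φ : (Fin d → ℝ) →ₗ[ℝ] ℝ), -φ x₀, hle, ?_, ?_⟩
    · have h1 := (le_and_mem_convexHull (f := (-φ : (Fin d → ℝ) →ₗ[ℝ] ℝ))
        (by rintro _ ⟨i, rfl⟩; exact hle i) hx₀.1).2 rfl
      obtain ⟨_, ⟨i, rfl⟩, hi⟩ := convexHull_nonempty_iff.1 ⟨_, h1⟩
      exact ⟨i, hi⟩
    · ext x
      refine and_congr_right fun hx => ⟨fun h => ?_, fun h y hy => ?_⟩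
      · exact congrArg Neg.neg (le_antisymm (hx₀.2 x hx) (h x₀ hx₀.1))
      · have h1 : φ x = φ x₀ := neg_injective h
        rw [h1]
        exact hx₀.2 y hy
  · rintro ⟨f, M, hle, ⟨i, hi⟩, rfl⟩
    refine ⟨⟨_, moment_mem t i, hi⟩, fun _ => ⟨-f.toContinuousLinearMap, ?_⟩⟩
    have hP : ∀ y ∈ cyclicPolytope d t, M ≤ f y := fun y hy =>
      (le_and_mem_convexHull (by rintro _ ⟨i, rfl⟩; exact hle i) hy).1
    ext x
    refine and_congr_right fun hx => ⟨fun h y hy => ?_, fun h => ?_⟩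
    · have := hP y hy
      simp only [neg_apply, LinearMap.coe_toContinuousLinearMap']
      linarith
    · have h1 := h _ (moment_mem t i)
      simp only [neg_apply, LinearMap.coe_toContinuousLinearMap'] at h1
      linarith [hP x hx]

variable {F : Set (Fin d → ℝ)}

theorem IsFace.subset (hF : IsFace (cyclicPolytope d t) F) : F ⊆ cyclicPolytope d t := by
  obtain ⟨f, M, -, -, rfl⟩ := isFace_iff.1 hF
  exact fun x hx => hx.1

theorem IsFace.convex (hF : IsFace (cyclicPolytope d t) F) : Convex ℝ F := by
  obtain ⟨f, M, -, -, rfl⟩ := isFace_iff.1 hF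
  exact convex_cyclicPolytope.inter (convex_hyperplane f.isLinear M)

theorem IsFace.eq_convexHull (hF : IsFace (cyclicPolytope d t) F) :
    F = convexHull ℝ ((fun i => moment d (t i)) '' {i | moment d (t i) ∈ F}) := by
  refine Set.Subset.antisymm (fun x hx => ?_) (convexHull_min ?_ hF.convex)
  · obtain ⟨f, M, hle, -, rfl⟩ := isFace_iff.1 hF
    refine convexHull_mono ?_
      ((le_and_mem_convexHull (by rintro _ ⟨i, rfl⟩; exact hle i) hx.1).2 hx.2)
    rintro _ ⟨⟨i, rfl⟩, hi⟩
    exact ⟨i, ⟨moment_mem t i, hi⟩, rfl⟩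
  · rintro _ ⟨i, hi, rfl⟩
    exact hi

theorem IsFace.exists_moment_mem (hF : IsFace (cyclicPolytope d t) F) :
    ∃ i, moment d (t i) ∈ F := by
  obtain ⟨f, M, -, ⟨i, hi⟩, rfl⟩ := isFace_iff.1 hF
  exact ⟨i, moment_mem t i, hi⟩

/-- Faces are extreme subsets. -/
theorem IsFace.mem_of_combo (hF : IsFace (cyclicPolytope d t) F) {x y : Fin d → ℝ}
    (hx : x ∈ cyclicPolytope d t) (hy : y ∈ cyclicPolytope d t) {α β : ℝ} (hα : 0 < α) (hβ : 0 ≤ β)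
    (hαβ : α + β = 1) (h : α • x + β • y ∈ F) : x ∈ F := by
  obtain ⟨f, M, hle, -, rfl⟩ := isFace_iff.1 hF
  have hP : ∀ y ∈ cyclicPolytope d t, M ≤ f y := fun y hy =>
    (le_and_mem_convexHull (by rintro _ ⟨i, rfl⟩; exact hle i) hy).1
  refine ⟨hx, ?_⟩
  have h1 := h.2
  rw [map_add, map_smul, map_smul, smul_eq_mul, smul_eq_mul] at h1
  have h2 := mul_nonneg hα.le (sub_nonneg.2 (hP x hx))
  have h3 := mul_nonneg hβ (sub_nonneg.2 (hP y hy))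
  have h4 : α * (f x - M) = 0 := by
    have : α * (f x - M) + β * (f y - M) = 0 := by linear_combination h1 - M * hαβ
    linarith
  linarith [(mul_eq_zero.1 h4).resolve_left hα.ne']

/-- If an affine functional is zero at the vertices with indices in `S` and positive at the others,
then the former span a face, the zero set of the functional in the polytope. -/
theorem isFace_convexHull_of_sign {S : Set (Fin n)} (hS : S.Nonempty) (f : (Fin d → ℝ) →ₗ[ℝ] ℝ)
    (M : ℝ) (hle : ∀ i, M ≤ f (moment d (t i))) (hz : ∀ i, f (moment d (t i)) = M ↔ i ∈ S) :
    IsFace (cyclicPolytope d t) (convexHull ℝ ((fun i => moment d (t i)) '' S)) ∧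
      convexHull ℝ ((fun i => moment d (t i)) '' S) = {x | x ∈ cyclicPolytope d t ∧ f x = M} := by
  have hface : IsFace (cyclicPolytope d t) {x | x ∈ cyclicPolytope d t ∧ f x = M} :=
    isFace_iff.2 ⟨f, M, hle, by obtain ⟨i, hi⟩ := hS; exact ⟨i, (hz i).2 hi⟩, rfl⟩
  have heq := hface.eq_convexHull
  have hset : {i | moment d (t i) ∈ {x | x ∈ cyclicPolytope d t ∧ f x = M}} = S := by
    ext i
    exact ⟨fun h => (hz i).1 h.2, fun h => ⟨moment_mem t i, (hz i).2 h⟩⟩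
  rw [hset] at heq
  exact ⟨heq ▸ hface, heq.symm⟩

/-- Which sets of vertices span faces does not depend on the parameters. -/
theorem isFace_transport {t' : Fin n → ℝ} (ht : StrictMono t) (ht' : StrictMono t')
    (hF : IsFace (cyclicPolytope d t) F) :
    IsFace (cyclicPolytope d t') (transport t t' F) ∧
      ∀ i, moment d (t' i) ∈ transport t t' F ↔ moment d (t i) ∈ F := by
  obtain ⟨f, M, hle, hne, hFeq⟩ := isFace_iff.1 hF
  have h1 := (exists_sign_affine_iff ht d
    (fun i => SignType.sign (f (moment d (t i)) - M))).1 ⟨f, M, fun _ => rfl⟩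
  obtain ⟨f', M', hf'⟩ := (exists_sign_affine_iff ht' d _).2 h1
  have hmem : ∀ i, f' (moment d (t' i)) = M' ↔ moment d (t i) ∈ F := by
    intro i
    have h2 := hf' i
    rw [← sub_eq_zero, ← sign_eq_zero_iff, h2, sign_eq_zero_iff, sub_eq_zero, hFeq]
    exact ⟨fun h => ⟨moment_mem t i, h⟩, fun h => h.2⟩
  have hle' : ∀ i, M' ≤ f' (moment d (t' i)) := by
    intro i
    rw [← sub_nonneg, ← sign_nonneg_iff, hf' i, sign_nonneg_iff, sub_nonneg]
    exact hle i
  obtain ⟨h2, h3⟩ := isFace_convexHull_of_sign (S := {i | moment d (t i) ∈ F})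
    hF.exists_moment_mem f' M' hle' hmem
  refine ⟨h2, fun i => ?_⟩
  rw [transport, h3, ← hmem]
  exact ⟨fun h => h.2, fun h => ⟨moment_mem t' i, h⟩⟩

variable [NeZero d]

theorem firstCoord_moment (s : ℝ) : firstCoord d (moment d s) = s := by
  simp [firstCoord, moment]

theorem moment_injective (ht : StrictMono t) {i j : Fin n}
    (h : moment d (t i) = moment d (t j)) : i = j := by
  have := congrArg (firstCoord d) h
  rw [firstCoord_moment, firstCoord_moment] at this
  exact ht.injective this

theorem isFace_vertex (hd : 2 ≤ d) (ht : StrictMono t) (i : Fin n) :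
    IsFace (cyclicPolytope d t) {moment d (t i)} := by
  have hval : ∀ s, (LinearMap.proj (⟨1, hd⟩ : Fin d) - (2 * t i) • firstCoord d :
      (Fin d → ℝ) →ₗ[ℝ] ℝ) (moment d s) = (s - t i) ^ 2 - t i ^ 2 := by
    intro s
    rw [LinearMap.sub_apply, LinearMap.smul_apply, firstCoord_moment]
    simp only [LinearMap.proj_apply, moment, smul_eq_mul]
    ring
  have := (isFace_convexHull_of_sign (t := t) (S := {i}) ⟨i, rfl⟩
    (LinearMap.proj (⟨1, hd⟩ : Fin d) - (2 * t i) • firstCoord d) (-t i ^ 2) (fun j => by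
      rw [hval]
      nlinarith [sq_nonneg (t j - t i)]) (fun j => by
      rw [hval, Set.mem_singleton_iff]
      constructor
      · intro h
        have h1 : (t j - t i) ^ 2 = 0 := by linarith
        exact ht.injective (sub_eq_zero.1 (pow_eq_zero_iff two_ne_zero |>.1 h1))
      · rintro rfl
        ring)).1
  simpa using this

section Ends

variable [NeZero n]

open Classical in
/-- The index of the first vertex of a face (`0` for a set without vertices). -/
noncomputable def firstIndex (t : Fin n → ℝ) (F : Set (Fin d → ℝ)) : Fin n :=
  if h : (Finset.univ.filter fun i => moment d (t i) ∈ F).Nonempty then Finset.min' _ h else 0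

open Classical in
/-- The index of the last vertex of a face (`0` for a set without vertices). -/
noncomputable def lastIndex (t : Fin n → ℝ) (F : Set (Fin d → ℝ)) : Fin n :=
  if h : (Finset.univ.filter fun i => moment d (t i) ∈ F).Nonempty then Finset.max' _ h else 0

omit [NeZero d] in
theorem isLeast_firstIndex (hF : IsFace (cyclicPolytope d t) F) :
    IsLeast {i | moment d (t i) ∈ F} (firstIndex t F) := by
  classical
  have h : (Finset.univ.filter fun i => moment d (t i) ∈ F).Nonempty := by
    obtain ⟨i, hi⟩ := hF.exists_moment_mem
    exact ⟨i, by simpa using hi⟩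
  have := Finset.isLeast_min' _ h
  rw [firstIndex, dif_pos h]
  simpa using this

omit [NeZero d] in
theorem isGreatest_lastIndex (hF : IsFace (cyclicPolytope d t) F) :
    IsGreatest {i | moment d (t i) ∈ F} (lastIndex t F) := by
  classical
  have h : (Finset.univ.filter fun i => moment d (t i) ∈ F).Nonempty := by
    obtain ⟨i, hi⟩ := hF.exists_moment_mem
    exact ⟨i, by simpa using hi⟩
  have := Finset.isGreatest_max' _ h
  rw [lastIndex, dif_pos h]
  simpa using this

omit [NeZero d] in
theorem firstIndex_le_lastIndex (hF : IsFace (cyclicPolytope d t) F) :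
    firstIndex t F ≤ lastIndex t F :=
  (isLeast_firstIndex hF).2 (isGreatest_lastIndex hF).1

theorem le_firstCoord (ht : StrictMono t) (hF : IsFace (cyclicPolytope d t) F) {x : Fin d → ℝ}
    (hx : x ∈ F) : t (firstIndex t F) ≤ firstCoord d x ∧
      (firstCoord d x = t (firstIndex t F) → x = moment d (t (firstIndex t F))) := by
  rw [hF.eq_convexHull] at hx
  have h := le_and_mem_convexHull (f := firstCoord d) (M := t (firstIndex t F)) (by
    rintro _ ⟨i, hi, rfl⟩
    simp only [firstCoord_moment]
    exact ht.monotone ((isLeast_firstIndex hF).2 hi)) hx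
  refine ⟨h.1, fun heq => ?_⟩
  have hsub : {y | y ∈ (fun i => moment d (t i)) '' {i | moment d (t i) ∈ F} ∧
      firstCoord d y = t (firstIndex t F)} ⊆ {moment d (t (firstIndex t F))} := by
    rintro _ ⟨⟨i, hi, rfl⟩, h1⟩
    simp only [firstCoord_moment] at h1
    simp [h1]
  simpa using convexHull_mono hsub (h.2 heq)

theorem firstCoord_le (ht : StrictMono t) (hF : IsFace (cyclicPolytope d t) F) {x : Fin d → ℝ}
    (hx : x ∈ F) : firstCoord d x ≤ t (lastIndex t F) ∧
      (firstCoord d x = t (lastIndex t F) → x = moment d (t (lastIndex t F))) := by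
  rw [hF.eq_convexHull] at hx
  have h := le_and_mem_convexHull (f := -firstCoord d) (M := -t (lastIndex t F)) (by
    rintro _ ⟨i, hi, rfl⟩
    simp only [LinearMap.neg_apply, firstCoord_moment]
    exact neg_le_neg (ht.monotone ((isGreatest_lastIndex hF).2 hi))) hx
  refine ⟨neg_le_neg_iff.1 h.1, fun heq => ?_⟩
  have hsub : {y | y ∈ (fun i => moment d (t i)) '' {i | moment d (t i) ∈ F} ∧
      (-firstCoord d) y = -t (lastIndex t F)} ⊆ {moment d (t (lastIndex t F))} := by
    rintro _ ⟨⟨i, hi, rfl⟩, h1⟩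
    simp only [LinearMap.neg_apply, firstCoord_moment, neg_inj] at h1
    simp [h1]
  simpa using convexHull_mono hsub (h.2 (congrArg Neg.neg heq))

theorem initialFace_eq (ht : StrictMono t) (hF : IsFace (cyclicPolytope d t) F) :
    initialFace (firstCoord d) F = {moment d (t (firstIndex t F))} := by
  have hv := (isLeast_firstIndex hF).1
  ext x
  constructor
  · rintro ⟨hx, hmin⟩
    have h1 := hmin _ hv
    rw [firstCoord_moment] at h1
    exact (le_firstCoord ht hF hx).2 (le_antisymm h1 (le_firstCoord ht hF hx).1)
  · rintro rfl
    refine ⟨hv, fun y hy => ?_⟩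
    rw [firstCoord_moment]
    exact (le_firstCoord ht hF hy).1

theorem terminalFace_eq (ht : StrictMono t) (hF : IsFace (cyclicPolytope d t) F) :
    terminalFace (firstCoord d) F = {moment d (t (lastIndex t F))} := by
  have hv := (isGreatest_lastIndex hF).1
  ext x
  constructor
  · rintro ⟨hx, hmax⟩
    have h1 := hmax _ hv
    rw [firstCoord_moment] at h1
    exact (firstCoord_le ht hF hx).2 (le_antisymm (firstCoord_le ht hF hx).1 h1)
  · rintro rfl
    refine ⟨hv, fun y hy => ?_⟩
    rw [firstCoord_moment]
    exact (firstCoord_le ht hF hy).1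

theorem isLeast_image_firstCoord (ht : StrictMono t) (hF : IsFace (cyclicPolytope d t) F) :
    IsLeast (firstCoord d '' F) (t (firstIndex t F)) :=
  ⟨⟨_, (isLeast_firstIndex hF).1, firstCoord_moment _⟩, by
    rintro _ ⟨x, hx, rfl⟩
    exact (le_firstCoord ht hF hx).1⟩

theorem isGreatest_image_firstCoord (ht : StrictMono t) (hF : IsFace (cyclicPolytope d t) F) :
    IsGreatest (firstCoord d '' F) (t (lastIndex t F)) :=
  ⟨⟨_, (isGreatest_lastIndex hF).1, firstCoord_moment _⟩, by
    rintro _ ⟨x, hx, rfl⟩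
    exact (firstCoord_le ht hF hx).1⟩

end Ends

end Cyclic

/-! ### Chains of adjacent intervals -/

section Intervals

variable {α β : Type*} [LinearOrder β] {lo hi : α → β}

theorem pairwise_of_adjacent : ∀ {l : List α}, (l.IsChain fun x y => hi x = lo y) →
    (∀ x ∈ l, lo x ≤ hi x) → l.Pairwise fun x y => hi x ≤ lo y
  | [], _, _ => List.Pairwise.nil
  | [x], _, _ => List.pairwise_singleton _ x
  | x :: y :: l, hc, hle => by
    obtain ⟨hxy, hc'⟩ := List.isChain_cons_cons.1 hc
    have ih := pairwise_of_adjacent hc' fun z hz => hle z (List.mem_cons_of_mem _ hz)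
    refine List.pairwise_cons.2 ⟨fun z hz => ?_, ih⟩
    rcases List.mem_cons.1 hz with rfl | hz
    · exact hxy.le
    · exact hxy.le.trans ((hle y (by simp)).trans ((List.pairwise_cons.1 ih).1 z hz))

theorem eq_or_le_of_adjacent {l : List α} (hc : l.IsChain fun x y => hi x = lo y)
    (hle : ∀ x ∈ l, lo x ≤ hi x) {x y : α} (hx : x ∈ l) (hy : y ∈ l) :
    x = y ∨ hi x ≤ lo y ∨ hi y ≤ lo x := by
  have hp := pairwise_of_adjacent hc hle
  clear hc hle
  induction l with
  | nil => simp at hx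
  | cons z l ih =>
    obtain ⟨h1, h2⟩ := List.pairwise_cons.1 hp
    rcases List.mem_cons.1 hx with rfl | hx' <;> rcases List.mem_cons.1 hy with rfl | hy'
    · exact Or.inl rfl
    · exact Or.inr (Or.inl (h1 y hy'))
    · exact Or.inr (Or.inr (h1 x hx'))
    · exact ih hx' hy' h2

theorem exists_mem_Ico_of_adjacent {q : β} {l : List α} :
    (l.IsChain fun x y => hi x = lo y) → (∃ x ∈ l.head?, lo x ≤ q) → (∃ z ∈ l.getLast?, q < hi z) →
      ∃ y ∈ l, lo y ≤ q ∧ q < hi y := by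
  induction l with
  | nil => simp
  | cons x l ih =>
    rintro hc ⟨x', hx', hx⟩ ⟨z, hz, hqz⟩
    obtain rfl : x = x' := by simpa using hx'
    rcases lt_or_ge q (hi x) with h | h
    · exact ⟨x, by simp, hx, h⟩
    · cases l with
      | nil =>
        obtain rfl : x = z := by simpa using hz
        exact absurd hqz (not_lt.2 h)
      | cons y l =>
        obtain ⟨hxy, hc'⟩ := List.isChain_cons_cons.1 hc
        obtain ⟨w, hw, h1⟩ := ih hc' ⟨y, by simp, hxy ▸ h⟩
          ⟨z, by rwa [List.getLast?_cons_cons] at hz, hqz⟩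
        exact ⟨w, List.mem_cons_of_mem _ hw, h1⟩

theorem exists_mem_Ioc_of_adjacent {q : β} {l : List α} :
    (l.IsChain fun x y => hi x = lo y) → (∃ x ∈ l.head?, lo x < q) → (∃ z ∈ l.getLast?, q ≤ hi z) →
      ∃ y ∈ l, lo y < q ∧ q ≤ hi y := by
  induction l with
  | nil => simp
  | cons x l ih =>
    rintro hc ⟨x', hx', hx⟩ ⟨z, hz, hqz⟩
    obtain rfl : x = x' := by simpa using hx'
    rcases le_or_gt q (hi x) with h | h
    · exact ⟨x, by simp, hx, h⟩
    · cases l with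
      | nil =>
        obtain rfl : x = z := by simpa using hz
        exact absurd hqz (not_le.2 h)
      | cons y l =>
        obtain ⟨hxy, hc'⟩ := List.isChain_cons_cons.1 hc
        obtain ⟨w, hw, h1⟩ := ih hc' ⟨y, by simp, hxy ▸ h⟩
          ⟨z, by rwa [List.getLast?_cons_cons] at hz, hqz⟩
        exact ⟨w, List.mem_cons_of_mem _ hw, h1⟩

end Intervals

/-! ### Cellular strings in terms of vertex indices -/

section Strings

variable {n d : ℕ} [NeZero n] [NeZero d] {t : Fin n → ℝ} {σ : List (Set (Fin d → ℝ))}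

/-- The index of the last vertex `v_n` of a cyclic polytope. -/
def topIndex (n : ℕ) [NeZero n] : Fin n :=
  ⟨n - 1, Nat.sub_lt (NeZero.pos n) Nat.one_pos⟩

theorem le_topIndex (i : Fin n) : i ≤ topIndex n :=
  Nat.le_sub_one_of_lt i.2

/-- The vertex index that belongs to an entry of a sign vector. -/
def nodeIndex (i : Fin (n - 2)) : Fin n :=
  ⟨(i : ℕ) + 1, by omega⟩

/-- The indices of the vertices at which the subdivision given by `σ` has its break points. -/
def breakIndices (t : Fin n → ℝ) (σ : List (Set (Fin d → ℝ))) : Set (Fin n) :=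
  {k | ∃ F ∈ σ, k = firstIndex t F ∨ k = lastIndex t F}

/-- The combinatorial content of a cellular string: the index intervals of its faces are adjacent and
cover all indices. -/
theorem isCellularString_iff (ht : StrictMono t) :
    IsCellularString t σ ↔ (∀ F ∈ σ, IsFace (cyclicPolytope d t) F) ∧
      (∃ F ∈ σ.head?, firstIndex t F = 0) ∧ (∃ F ∈ σ.getLast?, lastIndex t F = topIndex n) ∧
        σ.IsChain fun F G => lastIndex t F = firstIndex t G := by
  constructor
  · rintro ⟨hface, ⟨F, hF, hF0⟩, ⟨G, hG, hGn⟩, hchain⟩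
    refine ⟨hface, ⟨F, hF, ?_⟩, ⟨G, hG, ?_⟩, ?_⟩
    · exact le_antisymm ((isLeast_firstIndex (hface F (List.mem_of_mem_head? hF))).2 hF0)
        (Fin.zero_le _)
    · exact le_antisymm (le_topIndex _)
        ((isGreatest_lastIndex (hface G (List.mem_of_mem_getLast? hG))).2 hGn)
    · refine hchain.imp_of_mem_imp fun F G hF hG ⟨c, hc, hc'⟩ => ht.injective ?_
      rw [← hc.unique (isGreatest_image_firstCoord ht (hface F hF)),
        ← hc'.unique (isLeast_image_firstCoord ht (hface G hG))]
  · rintro ⟨hface, ⟨F, hF, hF0⟩, ⟨G, hG, hGn⟩, hchain⟩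
    refine ⟨hface, ⟨F, hF, ?_⟩, ⟨G, hG, ?_⟩, ?_⟩
    · rw [← hF0]
      exact (isLeast_firstIndex (hface F (List.mem_of_mem_head? hF))).1
    · have := (isGreatest_lastIndex (hface G (List.mem_of_mem_getLast? hG))).1
      rwa [hGn] at this
    · refine hchain.imp_of_mem_imp fun F G hF hG h => ⟨t (lastIndex t F),
        isGreatest_image_firstCoord ht (hface F hF), ?_⟩
      rw [h]
      exact isLeast_image_firstCoord ht (hface G hG)

open Classical in
theorem signVector_eq (ht : StrictMono t) (hface : ∀ F ∈ σ, IsFace (cyclicPolytope d t) F)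
    (i : Fin (n - 2)) : signVector t σ i =
      if ∀ F ∈ σ, moment d (t (nodeIndex i)) ∉ F then 1
      else if nodeIndex i ∈ breakIndices t σ then -1 else 0 := by
  have h : (∃ F ∈ σ, moment d (t (nodeIndex i)) ∈ initialFace (firstCoord d) F ∨
      moment d (t (nodeIndex i)) ∈ terminalFace (firstCoord d) F) ↔
      nodeIndex i ∈ breakIndices t σ := by
    refine exists_congr fun F => and_congr_right fun hF => ?_
    rw [initialFace_eq ht (hface F hF), terminalFace_eq ht (hface F hF), Set.mem_singleton_iff,
      Set.mem_singleton_iff]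
    exact or_congr ⟨moment_injective ht, fun h => by rw [h]⟩
      ⟨moment_injective ht, fun h => by rw [h]⟩
  exact if_congr Iff.rfl rfl (if_congr h rfl rfl)

section Facts

variable (hσ : IsCellularString t σ) (ht : StrictMono t)
include hσ ht

theorem IsCellularString.adjacent : σ.IsChain fun F G => lastIndex t F = firstIndex t G :=
  ((isCellularString_iff ht).1 hσ).2.2.2

theorem IsCellularString.eq_or_le {F G : Set (Fin d → ℝ)} (hF : F ∈ σ) (hG : G ∈ σ) :
    F = G ∨ lastIndex t F ≤ firstIndex t G ∨ lastIndex t G ≤ firstIndex t F :=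
  eq_or_le_of_adjacent (hσ.adjacent ht) (fun F hF => firstIndex_le_lastIndex (hσ.isFace F hF)) hF hG

theorem IsCellularString.exists_Ico {q : ℝ} (h0 : t 0 ≤ q) (h1 : q < t (topIndex n)) :
    ∃ F ∈ σ, t (firstIndex t F) ≤ q ∧ q < t (lastIndex t F) := by
  obtain ⟨-, ⟨F, hF, hF0⟩, ⟨G, hG, hGn⟩, hchain⟩ := (isCellularString_iff ht).1 hσ
  exact exists_mem_Ico_of_adjacent (lo := fun F => t (firstIndex t F))
    (hi := fun F => t (lastIndex t F)) (hchain.imp fun _ _ h => congrArg t h)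
    ⟨F, hF, by rwa [hF0]⟩ ⟨G, hG, by rwa [hGn]⟩

theorem IsCellularString.exists_Ioc {q : ℝ} (h0 : t 0 < q) (h1 : q ≤ t (topIndex n)) :
    ∃ F ∈ σ, t (firstIndex t F) < q ∧ q ≤ t (lastIndex t F) := by
  obtain ⟨-, ⟨F, hF, hF0⟩, ⟨G, hG, hGn⟩, hchain⟩ := (isCellularString_iff ht).1 hσ
  exact exists_mem_Ioc_of_adjacent (lo := fun F => t (firstIndex t F))
    (hi := fun F => t (lastIndex t F)) (hchain.imp fun _ _ h => congrArg t h)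
    ⟨F, hF, by rwa [hF0]⟩ ⟨G, hG, by rwa [hGn]⟩

theorem IsCellularString.zero_mem_breakIndices : 0 ∈ breakIndices t σ := by
  obtain ⟨-, ⟨F, hF, hF0⟩, -⟩ := (isCellularString_iff ht).1 hσ
  exact ⟨F, List.mem_of_mem_head? hF, Or.inl hF0.symm⟩

theorem IsCellularString.topIndex_mem_breakIndices : topIndex n ∈ breakIndices t σ := by
  obtain ⟨-, -, ⟨F, hF, hF0⟩, -⟩ := (isCellularString_iff ht).1 hσ
  exact ⟨F, List.mem_of_mem_getLast? hF, Or.inr hF0.symm⟩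

/-- No break point lies strictly between the ends of a face. -/
theorem IsCellularString.break_le_or_ge {F : Set (Fin d → ℝ)} (hF : F ∈ σ) {k : Fin n}
    (hk : k ∈ breakIndices t σ) : k ≤ firstIndex t F ∨ lastIndex t F ≤ k := by
  obtain ⟨G, hG, hkG⟩ := hk
  have hle := firstIndex_le_lastIndex (hσ.isFace G hG)
  rcases hσ.eq_or_le ht hF hG with rfl | h | h <;> rcases hkG with rfl | rfl
  · exact Or.inl le_rfl
  · exact Or.inr le_rfl
  · exact Or.inr h
  · exact Or.inr (h.trans hle)
  · exact Or.inl (hle.trans h)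
  · exact Or.inl h

/-- A vertex strictly between the ends of a face lies in no other face of the string. -/
theorem IsCellularString.eq_of_mem {F G : Set (Fin d → ℝ)} (hF : F ∈ σ) (hG : G ∈ σ) {k : Fin n}
    (h1 : firstIndex t F < k) (h2 : k < lastIndex t F) (hk : moment d (t k) ∈ G) : F = G := by
  have h3 := (isLeast_firstIndex (hσ.isFace G hG)).2 hk
  have h4 := (isGreatest_lastIndex (hσ.isFace G hG)).2 hk
  rcases hσ.eq_or_le ht hF hG with h | h | h
  · exact h
  · exact absurd (h.trans h3) (not_le.2 h2)
  · exact absurd (h4.trans h) (not_le.2 h1)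

theorem IsCellularString.exists_breakSystem (hn : 2 ≤ n) :
    ∃ a c : Fin (n - 2) → ℝ, BreakSystem (t '' breakIndices t σ) (t 0) (t (topIndex n))
      (fun i => t (nodeIndex i)) a c := by
  have h0 : ∀ i : Fin (n - 2), (0 : Fin n) < nodeIndex i := fun i => by
    rw [Fin.lt_def, Fin.val_zero]
    exact Nat.succ_pos _
  have hn' : ∀ i : Fin (n - 2), nodeIndex i < topIndex n := fun i => by
    rw [Fin.lt_def]
    simp only [nodeIndex, topIndex]
    omega
  have ha : ∀ i : Fin (n - 2), ∃ a, a ∈ t '' breakIndices t σ ∧ a < t (nodeIndex i) ∧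
      ∀ b ∈ t '' breakIndices t σ, b < t (nodeIndex i) → b ≤ a := by
    intro i
    obtain ⟨a, ⟨h1, h2⟩, h3⟩ := Set.exists_max_image
      {b | b ∈ t '' breakIndices t σ ∧ b < t (nodeIndex i)} id
      ((Set.toFinite (t '' breakIndices t σ)).subset fun _ h => h.1)
      ⟨t 0, ⟨0, hσ.zero_mem_breakIndices ht, rfl⟩, ht (h0 i)⟩
    exact ⟨a, h1, h2, fun b hb hlt => h3 b ⟨hb, hlt⟩⟩
  have hc : ∀ i : Fin (n - 2), ∃ c, c ∈ t '' breakIndices t σ ∧ t (nodeIndex i) < c ∧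
      ∀ b ∈ t '' breakIndices t σ, t (nodeIndex i) < b → c ≤ b := by
    intro i
    obtain ⟨a, ⟨h1, h2⟩, h3⟩ := Set.exists_min_image
      {b | b ∈ t '' breakIndices t σ ∧ t (nodeIndex i) < b} id
      ((Set.toFinite (t '' breakIndices t σ)).subset fun _ h => h.1)
      ⟨t (topIndex n), ⟨_, hσ.topIndex_mem_breakIndices ht, rfl⟩, ht (hn' i)⟩
    exact ⟨a, h1, h2, fun b hb hlt => h3 b ⟨hb, hlt⟩⟩
  choose a ha1 ha2 ha3 using ha
  choose c hc1 hc2 hc3 using hc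
  refine ⟨a, c, ⟨⟨0, hσ.zero_mem_breakIndices ht, rfl⟩, ⟨_, hσ.topIndex_mem_breakIndices ht, rfl⟩,
    ht ?_, ?_, fun i => ht (h0 i), fun i => ht (hn' i), ha1, ha2, ha3, hc1, hc2, hc3⟩⟩
  · rw [Fin.lt_def, Fin.val_zero]
    simp only [topIndex]
    omega
  · rintro _ ⟨k, -, rfl⟩
    by_cases hk0 : (k : ℕ) = 0
    · exact Or.inl (congrArg t (Fin.ext hk0))
    by_cases hkn : (k : ℕ) = n - 1
    · exact Or.inr (Or.inl (congrArg t (Fin.ext hkn)))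
    · refine Or.inr (Or.inr ⟨⟨(k : ℕ) - 1, by omega⟩, congrArg t (Fin.ext ?_)⟩)
      simp only [nodeIndex]
      omega

end Facts

end Strings

/-! ### Induced families and supporting lines -/

section Coherence

variable {n d : ℕ} [NeZero n] [NeZero d] {t : Fin n → ℝ} {F : Set (Fin d → ℝ)}

/-- The line `s ↦ m s + M` lies below the heights that `f` gives to the vertices, and touches them
exactly at the vertices in `F`. -/
def Supports (t : Fin n → ℝ) (f : (Fin d → ℝ) →ₗ[ℝ] ℝ) (F : Set (Fin d → ℝ)) (m M : ℝ) : Prop :=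
  ∀ i, M ≤ f (moment d (t i)) - m * t i ∧
    (moment d (t i) ∈ F ↔ f (moment d (t i)) - m * t i = M)

omit [NeZero n] in
/-- A face contains a convex subset of the polytope as soon as it contains a fiber of this subset
between two of its vertices. -/
theorem IsFace.subset_of_fiber (hF : IsFace (cyclicPolytope d t) F) {K : Set (Fin d → ℝ)}
    (hK : Convex ℝ K) (hKP : K ⊆ cyclicPolytope d t) {i j : Fin n} (hi : moment d (t i) ∈ K)
    (hj : moment d (t j) ∈ K) {q : ℝ} (hiq : t i < q) (hqj : q < t j)
    (h : ∀ x ∈ K, firstCoord d x = q → x ∈ F) : K ⊆ F := by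
  intro x hx
  rcases lt_trichotomy (firstCoord d x) q with hlt | heq | hgt
  · have h1 : 0 < t j - firstCoord d x := by linarith
    have h2 : 0 < t j - q := by linarith
    have h3 : 0 < q - firstCoord d x := by linarith
    have hsum : (t j - q) / (t j - firstCoord d x) + (q - firstCoord d x) / (t j - firstCoord d x)
        = 1 := by
      field_simp
      ring
    refine hF.mem_of_combo (hKP hx) (hKP hj) (div_pos h2 h1) (div_pos h3 h1).le hsum
      (h _ (hK hx hj (div_pos h2 h1).le (div_pos h3 h1).le hsum) ?_)
    rw [map_add, map_smul, map_smul, firstCoord_moment, smul_eq_mul, smul_eq_mul]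
    field_simp
    ring
  · exact h x hx heq
  · have h1 : 0 < firstCoord d x - t i := by linarith
    have h2 : 0 < q - t i := by linarith
    have h3 : 0 < firstCoord d x - q := by linarith
    have hsum : (q - t i) / (firstCoord d x - t i) + (firstCoord d x - q) / (firstCoord d x - t i)
        = 1 := by
      field_simp
      ring
    refine hF.mem_of_combo (hKP hx) (hKP hi) (div_pos h2 h1) (div_pos h3 h1).le hsum
      (h _ (hK hx hi (div_pos h2 h1).le (div_pos h3 h1).le hsum) ?_)
    rw [map_add, map_smul, map_smul, firstCoord_moment, smul_eq_mul, smul_eq_mul]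
    field_simp
    ring

omit [NeZero n] in
theorem fiberMin_nonempty (f : (Fin d → ℝ) →ₗ[ℝ] ℝ) {q : ℝ}
    (hq : q ∈ firstCoord d '' cyclicPolytope d t) :
    (fiberMin (firstCoord d) (cyclicPolytope d t) f q).Nonempty := by
  have hπ : Continuous (firstCoord d) := LinearMap.continuous_of_finiteDimensional _
  have hf : Continuous f := LinearMap.continuous_of_finiteDimensional _
  have hP : IsCompact (cyclicPolytope d t) := (Set.finite_range _).isCompact_convexHull ℝ
  have hcomp : IsCompact (cyclicPolytope d t ∩ {x | firstCoord d x = q}) :=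
    hP.inter_right (isClosed_eq hπ continuous_const)
  obtain ⟨y, hy, hyq⟩ := hq
  obtain ⟨x, hx, hmin⟩ := hcomp.exists_isMinOn ⟨y, hy, hyq⟩ hf.continuousOn
  exact ⟨x, hx.1, hx.2, fun z hz hzq => hmin ⟨hz, hzq⟩⟩

omit [NeZero n] in
/-- Over an interior point of the segment, the lower hull of the vertices has a supporting line; its
slope is the largest one towards the vertices on the left. -/
theorem exists_supporting_slope {f : (Fin d → ℝ) →ₗ[ℝ] ℝ} {q : ℝ} {x : Fin d → ℝ}
    (hx : x ∈ fiberMin (firstCoord d) (cyclicPolytope d t) f q) {i₀ : Fin n} (hi₀ : t i₀ < q) :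
    ∃ m, ∀ k, f x - m * q ≤ f (moment d (t k)) - m * t k := by
  obtain ⟨i, hi, hmax⟩ := Set.exists_max_image {i | t i < q}
    (fun i => (f x - f (moment d (t i))) / (q - t i)) (Set.toFinite _) ⟨i₀, hi₀⟩
  refine ⟨(f x - f (moment d (t i))) / (q - t i), fun k => ?_⟩
  have hqi : 0 < q - t i := sub_pos.2 hi
  rcases lt_trichotomy (t k) q with hk | hk | hk
  · have h1 := hmax k hk
    have hqk : 0 < q - t k := sub_pos.2 hk
    rw [div_le_iff₀ hqk] at h1
    linarith
  · have := hx.2.2 _ (moment_mem t k) (by rw [firstCoord_moment, hk])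
    rw [hk] at this ⊢
    linarith
  · have hki : 0 < t k - t i := by linarith
    have hsum : (t k - q) / (t k - t i) + (q - t i) / (t k - t i) = 1 := by
      field_simp
      ring
    have h1 := hx.2.2 _ (convex_cyclicPolytope (moment_mem t i) (moment_mem t k)
      (div_nonneg (sub_pos.2 hk).le hki.le) (div_nonneg hqi.le hki.le) hsum) (by
        rw [map_add, map_smul, map_smul, firstCoord_moment, firstCoord_moment, smul_eq_mul,
          smul_eq_mul]
        field_simp
        ring)
    rw [map_add, map_smul, map_smul, smul_eq_mul, smul_eq_mul, div_mul_eq_mul_div,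
      div_mul_eq_mul_div, ← add_div, le_div_iff₀ hki] at h1
    have h2 : (f x - f (moment d (t i))) / (q - t i) * (q - t i) = f x - f (moment d (t i)) :=
      div_mul_cancel₀ _ hqi.ne'
    set m := (f x - f (moment d (t i))) / (q - t i)
    have h3 : 0 ≤ (q - t i) * (f (moment d (t k)) - m * t k - (f x - m * q)) := by
      have : f (moment d (t i)) = f x - m * (q - t i) := by linarith
      rw [this] at h1
      nlinarith
    linarith [nonneg_of_mul_nonneg_right h3 hqi]

/-- A face that is not a vertex and is induced by `f` lies over an edge of the lower hull. -/
theorem exists_supports (hd : 2 ≤ d) (ht : StrictMono t) (hF : IsFace (cyclicPolytope d t) F)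
    (hlt : firstIndex t F < lastIndex t F) {f : (Fin d → ℝ) →ₗ[ℝ] ℝ} {q : ℝ}
    (hq : q ∈ firstCoord d '' cyclicPolytope d t)
    (hleast : IsLeast {G | IsFace (cyclicPolytope d t) G ∧
      fiberMin (firstCoord d) (cyclicPolytope d t) f q ⊆ G} F) : ∃ m M, Supports t f F m M := by
  obtain ⟨x, hx⟩ := fiberMin_nonempty f hq
  have hxF : x ∈ F := hleast.1.2 hx
  have hv := (isLeast_firstIndex hF).1
  have hv' := (isGreatest_lastIndex hF).1
  -- the fiber lies over an interior point of `F`, for otherwise `F` would be a vertex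
  have hsingle : ∀ k : Fin n, fiberMin (firstCoord d) (cyclicPolytope d t) f q ⊆
      {moment d (t k)} → False := by
    intro k hk
    have h1 := hleast.2 ⟨isFace_vertex hd ht k, hk⟩
    exact hlt.ne (moment_injective ht ((h1 hv).trans (h1 hv').symm))
  have h1 : t (firstIndex t F) < q := by
    refine lt_of_le_of_ne (hx.2.1 ▸ (le_firstCoord ht hF hxF).1) fun heq => ?_
    exact hsingle (firstIndex t F) fun y hy =>
      (le_firstCoord ht hF (hleast.1.2 hy)).2 (hy.2.1.trans heq.symm)
  have h2 : q < t (lastIndex t F) := by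
    refine lt_of_le_of_ne (hx.2.1 ▸ (firstCoord_le ht hF hxF).1) fun heq => ?_
    exact hsingle (lastIndex t F) fun y hy =>
      (firstCoord_le ht hF (hleast.1.2 hy)).2 (hy.2.1.trans heq)
  obtain ⟨m, hm⟩ := exists_supporting_slope hx h1
  have hval : ∀ y, (f - m • firstCoord d) y = f y - m * firstCoord d y := fun y => by simp
  have hval' : ∀ i, (f - m • firstCoord d) (moment d (t i)) = f (moment d (t i)) - m * t i :=
    fun i => by rw [hval, firstCoord_moment]
  have hle : ∀ y ∈ cyclicPolytope d t, f x - m * q ≤ f y - m * firstCoord d y := fun y hy => by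
    have := (le_and_mem_convexHull (f := f - m • firstCoord d) (M := f x - m * q) (by
      rintro _ ⟨i, rfl⟩
      rw [hval']
      exact hm i) hy).1
    rwa [hval] at this
  have hK : Convex ℝ {y | y ∈ cyclicPolytope d t ∧ (f - m • firstCoord d) y = f x - m * q} :=
    convex_cyclicPolytope.inter (convex_hyperplane (f - m • firstCoord d).isLinear _)
  have hfib : ∀ y ∈ fiberMin (firstCoord d) (cyclicPolytope d t) f q, f y = f x := fun y hy =>
    le_antisymm (hy.2.2 x hx.1 hx.2.1) (hx.2.2 y hy.1 hy.2.1)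
  have hface : IsFace (cyclicPolytope d t)
      {y | y ∈ cyclicPolytope d t ∧ (f - m • firstCoord d) y = f x - m * q} := by
    refine isFace_iff.2 ⟨_, _, fun i => by rw [hval']; exact hm i, ?_, rfl⟩
    have hmem := (le_and_mem_convexHull (f := f - m • firstCoord d) (M := f x - m * q) (by
      rintro _ ⟨i, rfl⟩
      rw [hval']
      exact hm i) hx.1).2 (by rw [hval, hx.2.1])
    obtain ⟨_, ⟨i, rfl⟩, hi⟩ := convexHull_nonempty_iff.1 ⟨_, hmem⟩
    exact ⟨i, hi⟩
  have hsub : F ⊆ {y | y ∈ cyclicPolytope d t ∧ (f - m • firstCoord d) y = f x - m * q} :=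
    hleast.2 ⟨hface, fun y hy => ⟨hy.1, by rw [hval, hy.2.1, hfib y hy]⟩⟩
  have hsub' := hF.subset_of_fiber hK (fun y hy => hy.1) (hsub hv) (hsub hv') h1 h2
    fun y hy hyq => hleast.1.2 ⟨hy.1, hyq, fun z hz hzq => by
      have h3 := hy.2
      rw [hval, hyq] at h3
      have h4 := hx.2.2 z hz hzq
      linarith⟩
  refine ⟨m, f x - m * q, fun i => ⟨hm i, fun h => ?_, fun h => hsub' ⟨moment_mem t i, ?_⟩⟩⟩
  · rw [← hval', (hsub h).2]
  · rw [hval', h]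

omit [NeZero n] in
theorem Supports.le {f : (Fin d → ℝ) →ₗ[ℝ] ℝ} {m M : ℝ} (h : Supports t f F m M) :
    ∀ y ∈ cyclicPolytope d t, M ≤ f y - m * firstCoord d y := fun y hy => by
  have := (le_and_mem_convexHull (f := f - m • firstCoord d) (M := M) (by
    rintro _ ⟨i, rfl⟩
    simpa [firstCoord_moment] using (h i).1) hy).1
  simpa using this

omit [NeZero n] in
theorem Supports.mem_iff {f : (Fin d → ℝ) →ₗ[ℝ] ℝ} {m M : ℝ} (h : Supports t f F m M)
    (hF : IsFace (cyclicPolytope d t) F) {y : Fin d → ℝ} :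
    y ∈ F ↔ y ∈ cyclicPolytope d t ∧ f y - m * firstCoord d y = M := by
  have h1 := (isFace_convexHull_of_sign (t := t) (S := {i | moment d (t i) ∈ F})
    hF.exists_moment_mem (f - m • firstCoord d) M
    (fun i => by simpa [firstCoord_moment] using (h i).1)
    (fun i => by simpa [firstCoord_moment] using (h i).2.symm)).2
  rw [← hF.eq_convexHull] at h1
  conv_lhs => rw [h1]
  simp

/-- The face over an edge of the lower hull is induced at all interior points of the edge. -/
theorem Supports.isLeast_face {f : (Fin d → ℝ) →ₗ[ℝ] ℝ} {m M : ℝ}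
    (h : Supports t f F m M) (hF : IsFace (cyclicPolytope d t) F) {q : ℝ}
    (h1 : t (firstIndex t F) < q) (h2 : q < t (lastIndex t F)) :
    IsLeast {G | IsFace (cyclicPolytope d t) G ∧
      fiberMin (firstCoord d) (cyclicPolytope d t) f q ⊆ G} F := by
  have hv := (isLeast_firstIndex hF).1
  have hv' := (isGreatest_lastIndex hF).1
  have hpos : 0 < t (lastIndex t F) - t (firstIndex t F) := by linarith
  -- a point of `F` over `q`
  obtain ⟨z, hz, hzq⟩ : ∃ z ∈ F, firstCoord d z = q := by
    refine ⟨_, hF.convex hv hv' (div_nonneg (sub_pos.2 h2).le hpos.le)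
      (div_nonneg (sub_pos.2 h1).le hpos.le) (by field_simp; ring), ?_⟩
    rw [map_add, map_smul, map_smul, firstCoord_moment, firstCoord_moment, smul_eq_mul, smul_eq_mul]
    field_simp
    ring
  have hz' := (h.mem_iff hF).1 hz
  refine ⟨⟨hF, fun y hy => (h.mem_iff hF).2 ⟨hy.1, ?_⟩⟩, ?_⟩
  · have h3 := hy.2.2 z hz'.1 hzq
    have h4 := h.le y hy.1
    have h5 := hz'.2
    rw [hzq] at h5
    rw [hy.2.1] at h4 ⊢
    linarith
  · rintro G ⟨hG, hsub⟩
    refine hG.subset_of_fiber hF.convex hF.subset hv hv' h1 h2 fun y hy hyq => hsub ⟨hF.subset hy,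
      hyq, fun w hw hwq => ?_⟩
    have h3 := ((h.mem_iff hF).1 hy).2
    have h4 := h.le w hw
    rw [hyq] at h3
    rw [hwq] at h4
    linarith

/-- The end vertices of an edge of the lower hull are induced at their projections. -/
theorem Supports.isLeast_vertex (hd : 2 ≤ d) (ht : StrictMono t) {f : (Fin d → ℝ) →ₗ[ℝ] ℝ}
    {m M : ℝ} (h : Supports t f F m M) (hF : IsFace (cyclicPolytope d t) F) {k : Fin n}
    (hk : k = firstIndex t F ∨ k = lastIndex t F) :
    IsLeast {G | IsFace (cyclicPolytope d t) G ∧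
      fiberMin (firstCoord d) (cyclicPolytope d t) f (t k) ⊆ G} {moment d (t k)} := by
  have hkF : moment d (t k) ∈ F := by
    rcases hk with rfl | rfl
    · exact (isLeast_firstIndex hF).1
    · exact (isGreatest_lastIndex hF).1
  have h1 := ((h.mem_iff hF).1 hkF).2
  rw [firstCoord_moment] at h1
  have hmem : moment d (t k) ∈ fiberMin (firstCoord d) (cyclicPolytope d t) f (t k) := by
    refine ⟨moment_mem t k, firstCoord_moment _, fun y hy hyk => ?_⟩
    have h2 := h.le y hy
    rw [hyk] at h2
    linarith
  refine ⟨⟨isFace_vertex hd ht k, fun y hy => ?_⟩, ?_⟩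
  · have hyF : y ∈ F := (h.mem_iff hF).2 ⟨hy.1, by
      have h2 := hy.2.2 _ (moment_mem t k) (firstCoord_moment _)
      have h3 := h.le y hy.1
      rw [hy.2.1] at h3 ⊢
      linarith⟩
    rcases hk with rfl | rfl
    · exact (le_firstCoord ht hF hyF).2 hy.2.1
    · exact (firstCoord_le ht hF hyF).2 hy.2.1
  · rintro G ⟨-, hsub⟩ y rfl
    exact hsub hmem

variable {σ : List (Set (Fin d → ℝ))}

/-- A string is coherent when, for some heights of the vertices, each of its faces that is not a
vertex consists of the points over an edge of the lower hull. -/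
theorem isCoherent_iff_supports (hd : 2 ≤ d) (hn : 2 ≤ n) (ht : StrictMono t)
    (hσ : IsCellularString t σ) :
    IsCoherent t σ ↔ ∃ f : (Fin d → ℝ) →ₗ[ℝ] ℝ, ∀ F ∈ σ, firstIndex t F < lastIndex t F →
      ∃ m M, Supports t f F m M := by
  have h0n : t 0 < t (topIndex n) := ht (by
    rw [Fin.lt_def, Fin.val_zero]
    simp only [topIndex]
    omega)
  refine exists_congr fun f => ⟨fun heq F hF hlt => ?_, fun hsup => ?_⟩
  · have hmem : F ∈ stringFamily (firstCoord d) σ := ⟨F, hF, Or.inl rfl⟩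
    rw [← heq] at hmem
    obtain ⟨q, hq, hleast⟩ := hmem
    exact exists_supports hd ht (hσ.isFace F hF) hlt hq hleast
  · have hvertex : ∀ F ∈ σ, firstIndex t F < lastIndex t F → ∀ k,
        k = firstIndex t F ∨ k = lastIndex t F →
        {moment d (t k)} ∈ inducedFamily (firstCoord d) (cyclicPolytope d t) f := by
      intro F hF hlt k hk
      obtain ⟨m, M, hs⟩ := hsup F hF hlt
      exact ⟨t k, ⟨_, moment_mem t k, firstCoord_moment _⟩,
        hs.isLeast_vertex hd ht (hσ.isFace F hF) hk⟩
    have hvertex' : ∀ F ∈ σ, ∀ k, k = firstIndex t F ∨ k = lastIndex t F →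
        {moment d (t k)} ∈ inducedFamily (firstCoord d) (cyclicPolytope d t) f := by
      intro F hF k hk
      rcases (firstIndex_le_lastIndex (hσ.isFace F hF)).eq_or_lt with heq | hlt
      · -- a vertex of the string is also an end of a face that is not a vertex
        have hkB : k ∈ breakIndices t σ := ⟨F, hF, hk⟩
        rcases (le_topIndex k).eq_or_lt with rfl | hkn
        · obtain ⟨G, hG, h1, h2⟩ := hσ.exists_Ioc ht h0n le_rfl
          have h1' := ht.lt_iff_lt.1 h1
          have h2' := ht.le_iff_le.1 h2
          refine hvertex G hG (h1'.trans_le h2') _ (Or.inr ?_)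
          exact le_antisymm h2' (le_topIndex _)
        · obtain ⟨G, hG, h1, h2⟩ := hσ.exists_Ico ht (ht.monotone (Fin.zero_le k)) (ht hkn)
          have h1' := ht.le_iff_le.1 h1
          have h2' := ht.lt_iff_lt.1 h2
          refine hvertex G hG (h1'.trans_lt h2') _ (Or.inl ?_)
          rcases hσ.break_le_or_ge ht hG hkB with h3 | h3
          · exact le_antisymm h3 h1'
          · exact absurd h2' (not_lt.2 h3)
      · exact hvertex F hF hlt k hk
    refine Set.Subset.antisymm ?_ ?_
    · rintro G ⟨q, ⟨x, hx, rfl⟩, hleast⟩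
      have hx0 : t 0 ≤ firstCoord d x := (le_and_mem_convexHull (f := firstCoord d) (by
        rintro _ ⟨i, rfl⟩
        simp only [firstCoord_moment]
        exact ht.monotone (Fin.zero_le i)) hx).1
      have hxn : firstCoord d x ≤ t (topIndex n) :=
        neg_le_neg_iff.1 (le_and_mem_convexHull (f := -firstCoord d) (by
          rintro _ ⟨i, rfl⟩
          simp only [LinearMap.neg_apply, firstCoord_moment]
          exact neg_le_neg (ht.monotone (le_topIndex i))) hx).1
      rcases hxn.eq_or_lt with heq | hlt
      · obtain ⟨F, hF, h1, h2⟩ := hσ.exists_Ioc ht (h0n.trans_eq heq.symm) heq.le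
        have hltF := ht.lt_iff_lt.1 (h1.trans_le h2)
        obtain ⟨m, M, hs⟩ := hsup F hF hltF
        have h3 : firstCoord d x = t (lastIndex t F) :=
          le_antisymm h2 (heq ▸ ht.monotone (le_topIndex _))
        rw [h3] at hleast
        refine ⟨F, hF, Or.inr (Or.inr ?_)⟩
        rw [terminalFace_eq ht (hσ.isFace F hF)]
        exact hleast.unique (hs.isLeast_vertex hd ht (hσ.isFace F hF) (Or.inr rfl))
      · obtain ⟨F, hF, h1, h2⟩ := hσ.exists_Ico ht hx0 hlt
        have hltF := ht.lt_iff_lt.1 (h1.trans_lt h2)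
        obtain ⟨m, M, hs⟩ := hsup F hF hltF
        rcases h1.eq_or_lt with h3 | h3
        · rw [← h3] at hleast
          refine ⟨F, hF, Or.inr (Or.inl ?_)⟩
          rw [initialFace_eq ht (hσ.isFace F hF)]
          exact hleast.unique (hs.isLeast_vertex hd ht (hσ.isFace F hF) (Or.inl rfl))
        · exact ⟨F, hF, Or.inl (hleast.unique (hs.isLeast_face (hσ.isFace F hF) h3 h2))⟩
    · rintro G ⟨F, hF, rfl | rfl | rfl⟩
      · have hface := hσ.isFace G hF
        rcases (firstIndex_le_lastIndex hface).eq_or_lt with heq | hlt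
        · have hG : G = {moment d (t (firstIndex t G))} := by
            refine Set.Subset.antisymm (fun y hy => (le_firstCoord ht hface hy).2 ?_)
              (Set.singleton_subset_iff.2 (isLeast_firstIndex hface).1)
            refine le_antisymm ?_ (le_firstCoord ht hface hy).1
            have := (firstCoord_le ht hface hy).1
            rwa [← heq] at this
          have h1 := hvertex' G hF _ (Or.inl rfl)
          rwa [← hG] at h1
        · obtain ⟨m, M, hs⟩ := hsup G hF hlt
          have hlt' := ht hlt
          refine ⟨(t (firstIndex t G) + t (lastIndex t G)) / 2, ?_,
            hs.isLeast_face hface (by linarith) (by linarith)⟩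
          refine ⟨_, hface.subset (hface.convex (isLeast_firstIndex hface).1
            (isGreatest_lastIndex hface).1 (a := 1 / 2) (b := 1 / 2) (by norm_num) (by norm_num)
            (by norm_num)), ?_⟩
          rw [map_add, map_smul, map_smul, firstCoord_moment, firstCoord_moment, smul_eq_mul,
            smul_eq_mul]
          ring
      · rw [initialFace_eq ht (hσ.isFace F hF)]
        exact hvertex' F hF _ (Or.inl rfl)
      · rw [terminalFace_eq ht (hσ.isFace F hF)]
        exact hvertex' F hF _ (Or.inr rfl)

end Coherence

/-! ### Coherence in terms of second differences -/

section Criterion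

variable {n d : ℕ} [NeZero n] [NeZero d] {t : Fin n → ℝ} {σ : List (Set (Fin d → ℝ))}

theorem secondDiff_sub_line (g : ℝ → ℝ) (m M a x c : ℝ) :
    secondDiff (fun s => g s - m * s - M) a x c = secondDiff g a x c := by
  rw [← secondDiff_add_affine g (-M) (-m)]
  congr 1
  funext s
  ring

variable {a c : Fin (n - 2) → ℝ}

theorem exists_face_of_break (hσ : IsCellularString t σ) (ht : StrictMono t)
    (hS : BreakSystem (t '' breakIndices t σ) (t 0) (t (topIndex n)) (fun i => t (nodeIndex i)) a c)
    (i : Fin (n - 2)) (hi : nodeIndex i ∈ breakIndices t σ) :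
    ∃ F ∈ σ, lastIndex t F = nodeIndex i ∧ firstIndex t F < lastIndex t F ∧
      a i = t (firstIndex t F) := by
  obtain ⟨F, hF, h1, h2⟩ := hσ.exists_Ioc ht (hS.lo_lt i) (hS.lt_hi i).le
  have h1' := ht.lt_iff_lt.1 h1
  have h2' := ht.le_iff_le.1 h2
  have hlast : lastIndex t F = nodeIndex i := by
    rcases hσ.break_le_or_ge ht hF hi with h | h
    · exact absurd h1' (not_lt.2 h)
    · exact le_antisymm h h2'
  refine ⟨F, hF, hlast, h1'.trans_le h2', le_antisymm ?_ ?_⟩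
  · obtain ⟨k, hk, hka⟩ := hS.a_mem i
    have hlt := hS.a_lt i
    rw [← hka] at hlt ⊢
    refine ht.monotone ((hσ.break_le_or_ge ht hF hk).resolve_right fun h => ?_)
    rw [hlast] at h
    exact absurd (ht.lt_iff_lt.1 hlt) (not_lt.2 h)
  · exact hS.le_a i _ ⟨_, ⟨F, hF, Or.inl rfl⟩, rfl⟩ h1

theorem ends_of_between (hσ : IsCellularString t σ) (ht : StrictMono t)
    (hS : BreakSystem (t '' breakIndices t σ) (t 0) (t (topIndex n)) (fun i => t (nodeIndex i)) a c)
    (i : Fin (n - 2)) {F : Set (Fin d → ℝ)} (hF : F ∈ σ) (h1 : firstIndex t F < nodeIndex i)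
    (h2 : nodeIndex i < lastIndex t F) :
    a i = t (firstIndex t F) ∧ c i = t (lastIndex t F) := by
  constructor
  · refine le_antisymm ?_ (hS.le_a i _ ⟨_, ⟨F, hF, Or.inl rfl⟩, rfl⟩ (ht h1))
    obtain ⟨k, hk, hka⟩ := hS.a_mem i
    have hlt := hS.a_lt i
    rw [← hka] at hlt ⊢
    refine ht.monotone ((hσ.break_le_or_ge ht hF hk).resolve_right fun h => ?_)
    exact absurd (h2.trans_le h) (not_lt.2 (ht.lt_iff_lt.1 hlt).le)
  · refine le_antisymm (hS.c_le i _ ⟨_, ⟨F, hF, Or.inr rfl⟩, rfl⟩ (ht h2)) ?_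
    obtain ⟨k, hk, hka⟩ := hS.c_mem i
    have hlt := hS.lt_c i
    rw [← hka] at hlt ⊢
    refine ht.monotone ((hσ.break_le_or_ge ht hF hk).resolve_left fun h => ?_)
    exact absurd (h.trans_lt h1) (not_lt.2 (ht.lt_iff_lt.1 hlt).le)

theorem exists_face_of_not_break (hσ : IsCellularString t σ) (ht : StrictMono t)
    (hS : BreakSystem (t '' breakIndices t σ) (t 0) (t (topIndex n)) (fun i => t (nodeIndex i)) a c)
    (i : Fin (n - 2)) (hi : nodeIndex i ∉ breakIndices t σ) :
    ∃ F ∈ σ, firstIndex t F < nodeIndex i ∧ nodeIndex i < lastIndex t F := by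
  obtain ⟨F, hF, h1, h2⟩ := hσ.exists_Ico ht (hS.lo_lt i).le (hS.lt_hi i)
  refine ⟨F, hF, lt_of_le_of_ne (ht.le_iff_le.1 h1) fun h => hi ⟨F, hF, Or.inl h.symm⟩,
    ht.lt_iff_lt.1 h2⟩

theorem signVector_of_break (hσ : IsCellularString t σ) (ht : StrictMono t) {i : Fin (n - 2)}
    (hi : nodeIndex i ∈ breakIndices t σ) : signVector t σ i = -1 := by
  rw [signVector_eq ht hσ.isFace, if_neg, if_pos hi]
  obtain ⟨F, hF, h⟩ := hi
  intro hall
  refine hall F hF ?_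
  rcases h with h | h
  · rw [h]
    exact (isLeast_firstIndex (hσ.isFace F hF)).1
  · rw [h]
    exact (isGreatest_lastIndex (hσ.isFace F hF)).1

open Classical in
theorem signVector_of_between (hσ : IsCellularString t σ) (ht : StrictMono t) {i : Fin (n - 2)}
    {F : Set (Fin d → ℝ)} (hF : F ∈ σ) (h1 : firstIndex t F < nodeIndex i)
    (h2 : nodeIndex i < lastIndex t F) :
    signVector t σ i = if moment d (t (nodeIndex i)) ∈ F then 0 else 1 := by
  rw [signVector_eq ht hσ.isFace]
  split_ifs with h3 h4 h5 h6 h7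
  · exact absurd h4 (h3 F hF)
  · rfl
  · exact absurd (hσ.break_le_or_ge ht hF h5) (by rw [not_or, not_le, not_le]; exact ⟨h1, h2⟩)
  · exact absurd (hσ.break_le_or_ge ht hF h5) (by rw [not_or, not_le, not_le]; exact ⟨h1, h2⟩)
  · rfl
  · push Not at h3
    obtain ⟨G, hG, hkG⟩ := h3
    rw [hσ.eq_of_mem ht hF hG h1 h2 hkG] at *
    contradiction

/-- Every face of the string has a supporting line exactly when the second differences of the
heights with respect to the adjacent break points have the signs recorded in the sign vector. -/
theorem forall_supports_iff (hσ : IsCellularString t σ) (ht : StrictMono t)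
    (hS : BreakSystem (t '' breakIndices t σ) (t 0) (t (topIndex n)) (fun i => t (nodeIndex i)) a c)
    (f : (Fin d → ℝ) →ₗ[ℝ] ℝ) :
    (∀ F ∈ σ, firstIndex t F < lastIndex t F → ∃ m M, Supports t f F m M) ↔
      ∀ i, SignType.sign (secondDiff (fun s => f (moment d s)) (a i) (t (nodeIndex i)) (c i)) =
        signVector t σ i := by
  classical
  constructor
  · intro hsup i
    by_cases hi : nodeIndex i ∈ breakIndices t σ
    · obtain ⟨F, hF, hlast, hlt, ha⟩ := exists_face_of_break hσ ht hS i hi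
      obtain ⟨m, M, hs⟩ := hsup F hF hlt
      rw [signVector_of_break hσ ht hi, sign_eq_neg_one_iff, ← secondDiff_sub_line _ m M]
      obtain ⟨k, -, hk⟩ := hS.c_mem i
      have hxc := hS.lt_c i
      rw [← hk] at hxc
      have h1 := (hs (firstIndex t F)).2.1 (isLeast_firstIndex (hσ.isFace F hF)).1
      have h2 := (hs (lastIndex t F)).2.1 (isGreatest_lastIndex (hσ.isFace F hF)).1
      have h3 : M < f (moment d (t k)) - m * t k := by
        refine lt_of_le_of_ne (hs k).1 fun h => ?_
        have h4 := (isGreatest_lastIndex (hσ.isFace F hF)).2 ((hs k).2.2 h.symm)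
        rw [hlast] at h4
        exact absurd (ht.lt_iff_lt.1 hxc) (not_lt.2 h4)
      rw [hlast] at h2
      have hax := hS.a_lt i
      rw [ha] at hax
      rw [secondDiff, ← hk, ha]
      have := mul_pos (sub_pos.2 hax) (sub_pos.2 h3)
      rw [h1, h2, sub_self, mul_zero, mul_zero]
      linarith
    · obtain ⟨F, hF, h1, h2⟩ := exists_face_of_not_break hσ ht hS i hi
      obtain ⟨m, M, hs⟩ := hsup F hF (h1.trans h2)
      obtain ⟨ha, hc⟩ := ends_of_between hσ ht hS i hF h1 h2
      have h3 := (hs (firstIndex t F)).2.1 (isLeast_firstIndex (hσ.isFace F hF)).1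
      have h4 := (hs (lastIndex t F)).2.1 (isGreatest_lastIndex (hσ.isFace F hF)).1
      have hpos : 0 < t (lastIndex t F) - t (firstIndex t F) := sub_pos.2 (ht (h1.trans h2))
      rw [signVector_of_between hσ ht hF h1 h2, ← secondDiff_sub_line _ m M, secondDiff, ha, hc, h3,
        h4, sub_self, mul_zero, mul_zero, sub_zero, sub_zero, sign_mul, sign_pos hpos, one_mul]
      split_ifs with h5
      · rw [(hs _).2.1 h5, sub_self, sign_zero]
      · exact sign_pos (sub_pos.2 (lt_of_le_of_ne (hs _).1 fun h => h5 ((hs _).2.2 h.symm)))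
  · intro hsign F hF hlt
    have hface := hσ.isFace F hF
    have hpos : 0 < t (lastIndex t F) - t (firstIndex t F) := sub_pos.2 (ht hlt)
    -- the line through the ends of `F`
    set u := t (firstIndex t F) with hu
    set v := t (lastIndex t F) with hv
    set m := (f (moment d v) - f (moment d u)) / (v - u) with hm
    set M := f (moment d u) - m * u with hM
    have hmul : m * (v - u) = f (moment d v) - f (moment d u) := div_mul_cancel₀ _ hpos.ne'
    set g : ℝ → ℝ := fun s => f (moment d s) - m * s - M with hg
    have hgu : g u = 0 := by
      simp only [hg, hM]
      ring
    have hgv : g v = 0 := by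
      simp only [hg, hM]
      linarith
    have hgs : ∀ i, SignType.sign (secondDiff g (a i) (t (nodeIndex i)) (c i)) =
        signVector t σ i := by
      intro i
      rw [← hsign i, hg, secondDiff_sub_line]
    have hconv : ∀ i, t (nodeIndex i) ∈ t '' breakIndices t σ →
        secondDiff g (a i) (t (nodeIndex i)) (c i) < 0 := by
      intro i hi
      rw [ht.injective.mem_set_image] at hi
      rw [← sign_eq_neg_one_iff, hgs, signVector_of_break hσ ht hi]
    have habove : ∀ i, t (nodeIndex i) ∉ t '' breakIndices t σ →
        0 ≤ secondDiff g (a i) (t (nodeIndex i)) (c i) := by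
      intro i hi
      rw [ht.injective.mem_set_image] at hi
      obtain ⟨G, hG, h1, h2⟩ := exists_face_of_not_break hσ ht hS i hi
      rw [← sign_nonneg_iff, hgs, signVector_of_between hσ ht hG h1 h2]
      split_ifs <;> decide
    have huB : u ∈ t '' breakIndices t σ := ⟨_, ⟨F, hF, Or.inl rfl⟩, rfl⟩
    have hvB : v ∈ t '' breakIndices t σ := ⟨_, ⟨F, hF, Or.inr rfl⟩, rfl⟩
    have hadj : ∀ β ∈ t '' breakIndices t σ, β ≤ u ∨ v ≤ β := by
      rintro _ ⟨k, hk, rfl⟩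
      exact (hσ.break_le_or_ge ht hF hk).imp (fun h => ht.monotone h) fun h => ht.monotone h
    obtain ⟨hr1, hr2⟩ := hS.pos_of_gt hconv habove huB hvB (sub_pos.1 hpos) hadj hgu hgv
    obtain ⟨hl1, hl2⟩ := hS.pos_of_lt hconv habove huB hvB (sub_pos.1 hpos) hadj hgu hgv
    have hcases : ∀ k : Fin n, k = 0 ∨ k = topIndex n ∨ ∃ i : Fin (n - 2), nodeIndex i = k := by
      intro k
      by_cases hk0 : (k : ℕ) = 0
      · exact Or.inl (Fin.ext hk0)
      by_cases hkn : (k : ℕ) = n - 1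
      · exact Or.inr (Or.inl (Fin.ext hkn))
      · refine Or.inr (Or.inr ⟨⟨(k : ℕ) - 1, by omega⟩, Fin.ext ?_⟩)
        simp only [nodeIndex]
        omega
    have hright : ∀ k, lastIndex t F < k → 0 < g (t k) := by
      intro k hk
      rcases hcases k with rfl | rfl | ⟨i, rfl⟩
      · exact absurd hk (Fin.not_lt_zero _)
      · exact hr1 _ hS.hi_mem (ht hk)
      · exact hr2 i (ht hk)
    have hleft : ∀ k, k < firstIndex t F → 0 < g (t k) := by
      intro k hk
      rcases hcases k with rfl | rfl | ⟨i, rfl⟩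
      · exact hl1 _ hS.lo_mem (ht hk)
      · exact absurd hk (not_lt.2 (le_topIndex _))
      · exact hl2 i (ht hk)
    have hmid : ∀ k, firstIndex t F < k → k < lastIndex t F →
        SignType.sign (g (t k)) = if moment d (t k) ∈ F then 0 else 1 := by
      intro k h1 h2
      rcases hcases k with rfl | rfl | ⟨i, rfl⟩
      · exact absurd h1 (Fin.not_lt_zero _)
      · exact absurd h2 (not_lt.2 (le_topIndex _))
      · obtain ⟨ha, hc⟩ := ends_of_between hσ ht hS i hF h1 h2
        have h3 := hgs i
        rwa [secondDiff, ha, hc, ← hu, ← hv, hgu, hgv, mul_zero, mul_zero, sub_zero, sub_zero,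
          sign_mul, sign_pos hpos, one_mul, signVector_of_between hσ ht hF h1 h2] at h3
    have key : ∀ k, 0 ≤ g (t k) ∧ (moment d (t k) ∈ F ↔ g (t k) = 0) := by
      intro k
      rcases lt_trichotomy k (firstIndex t F) with h | rfl | h
      · refine ⟨(hleft k h).le, fun hk => absurd h (not_lt.2 ((isLeast_firstIndex hface).2 hk)),
          fun hk => absurd hk (hleft k h).ne'⟩
      · exact ⟨hgu.ge, fun _ => hgu, fun _ => (isLeast_firstIndex hface).1⟩
      rcases lt_trichotomy k (lastIndex t F) with h' | rfl | h'
      · have h1 := hmid k h h'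
        split_ifs at h1 with h2
        · have h3 := sign_eq_zero_iff.1 h1
          exact ⟨h3.ge, fun _ => h3, fun _ => h2⟩
        · have h3 := sign_eq_one_iff.1 h1
          exact ⟨h3.le, fun h4 => absurd h4 h2, fun h4 => absurd h4 h3.ne'⟩
      · exact ⟨hgv.ge, fun _ => hgv, fun _ => (isGreatest_lastIndex hface).1⟩
      · refine ⟨(hright k h').le, fun hk => absurd h' (not_lt.2 ((isGreatest_lastIndex hface).2 hk)),
          fun hk => absurd hk (hright k h').ne'⟩
    refine ⟨m, M, fun k => ⟨?_, ?_⟩⟩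
    · have := (key k).1
      simp only [hg] at this
      linarith
    · rw [(key k).2, ← sub_eq_zero (b := M)]

/-- Coherence in terms of the sign vector alone. -/
theorem isCoherent_iff (hd : 2 ≤ d) (hn : 2 ≤ n) (ht : StrictMono t) (hσ : IsCellularString t σ) :
    IsCoherent t σ ↔ signVector t σ = 0 ∨ ¬ HasWeakAlternation (signVector t σ) d := by
  obtain ⟨a, c, hS⟩ := hσ.exists_breakSystem ht hn
  have hx : StrictMono fun i : Fin (n - 2) => t (nodeIndex i) := fun i j hij =>
    ht (Nat.succ_lt_succ hij)
  rw [← exists_sign_secondDiff_iff hS hx hd, isCoherent_iff_supports hd hn ht hσ]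
  exact exists_congr fun f => forall_supports_iff hσ ht hS f

/-- The sign vector of a string vanishes only if the whole polytope is one of its faces. -/
theorem signVector_ne_zero (hn : 2 ≤ n) (ht : StrictMono t) (hσ : IsCellularString t σ)
    (hP : cyclicPolytope d t ∉ σ) : signVector t σ ≠ 0 := by
  classical
  intro h0
  obtain ⟨a, c, hS⟩ := hσ.exists_breakSystem ht hn
  have hnb : ∀ i, nodeIndex i ∉ breakIndices t σ := fun i hi => by
    have h1 := signVector_of_break hσ ht hi
    rw [h0, Pi.zero_apply] at h1
    exact absurd h1 (by decide)
  obtain ⟨F, hF, h1, h2⟩ := hσ.exists_Ico ht le_rfl hS.lo_lt_hi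
  have hface := hσ.isFace F hF
  have hfirst : firstIndex t F = 0 :=
    le_antisymm (ht.le_iff_le.1 h1) (Fin.zero_le _)
  have hlast : lastIndex t F = topIndex n := by
    by_contra hne
    have h2' : (0 : ℕ) < (lastIndex t F : ℕ) := by
      have := Fin.lt_def.1 (ht.lt_iff_lt.1 h2)
      rwa [Fin.val_zero] at this
    have h3 : (lastIndex t F : ℕ) ≠ n - 1 := fun h => hne (Fin.ext h)
    have h4 : nodeIndex ⟨(lastIndex t F : ℕ) - 1, by omega⟩ = lastIndex t F := by
      apply Fin.ext
      simp only [nodeIndex]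
      omega
    exact hnb _ ⟨F, hF, Or.inr h4⟩
  have hall : ∀ k, moment d (t k) ∈ F := by
    intro k
    by_cases hk0 : (k : ℕ) = 0
    · have : k = firstIndex t F := by rw [hfirst]; exact Fin.ext hk0
      rw [this]
      exact (isLeast_firstIndex hface).1
    by_cases hkn : (k : ℕ) = n - 1
    · have : k = lastIndex t F := by rw [hlast]; exact Fin.ext hkn
      rw [this]
      exact (isGreatest_lastIndex hface).1
    have hk : nodeIndex ⟨(k : ℕ) - 1, by omega⟩ = k := by
      apply Fin.ext
      simp only [nodeIndex]
      omega
    have h3 := signVector_of_between hσ ht hF (i := ⟨(k : ℕ) - 1, by omega⟩) (by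
        rw [hk, hfirst, Fin.lt_def, Fin.val_zero]
        omega) (by
        rw [hk, hlast, Fin.lt_def]
        simp only [topIndex]
        omega)
    by_contra hkF
    rw [h0, hk, if_neg hkF, Pi.zero_apply] at h3
    exact absurd h3 (by decide)
  refine hP ?_
  have h3 : F = cyclicPolytope d t := by
    rw [hface.eq_convexHull, cyclicPolytope]
    congr 1
    ext x
    simp [hall]
  exact h3 ▸ hF

/-! ### Independence of the parameters -/

variable {t' : Fin n → ℝ}

omit [NeZero d] in
theorem firstIndex_transport (ht : StrictMono t) (ht' : StrictMono t') {F : Set (Fin d → ℝ)}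
    (hF : IsFace (cyclicPolytope d t) F) :
    firstIndex t' (transport t t' F) = firstIndex t F := by
  obtain ⟨h1, h2⟩ := isFace_transport ht ht' hF
  have h3 := isLeast_firstIndex h1
  simp only [h2] at h3
  exact h3.unique (isLeast_firstIndex hF)

omit [NeZero d] in
theorem lastIndex_transport (ht : StrictMono t) (ht' : StrictMono t') {F : Set (Fin d → ℝ)}
    (hF : IsFace (cyclicPolytope d t) F) :
    lastIndex t' (transport t t' F) = lastIndex t F := by
  obtain ⟨h1, h2⟩ := isFace_transport ht ht' hF
  have h3 := isGreatest_lastIndex h1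
  simp only [h2] at h3
  exact h3.unique (isGreatest_lastIndex hF)

theorem isCellularString_transport (ht : StrictMono t) (ht' : StrictMono t')
    (hσ : IsCellularString t σ) : IsCellularString t' (σ.map (transport t t')) := by
  obtain ⟨hface, ⟨F, hF, hF0⟩, ⟨G, hG, hGn⟩, hchain⟩ := (isCellularString_iff ht).1 hσ
  refine (isCellularString_iff ht').2 ⟨?_, ⟨transport t t' F, ?_, ?_⟩, ⟨transport t t' G, ?_, ?_⟩, ?_⟩
  · intro F' hF'
    obtain ⟨F, hF, rfl⟩ := List.mem_map.1 hF'
    exact (isFace_transport ht ht' (hface F hF)).1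
  · rw [List.head?_map]
    exact Option.mem_map_of_mem _ hF
  · rw [firstIndex_transport ht ht' (hface F (List.mem_of_mem_head? hF)), hF0]
  · rw [List.getLast?_map]
    exact Option.mem_map_of_mem _ hG
  · rw [lastIndex_transport ht ht' (hface G (List.mem_of_mem_getLast? hG)), hGn]
  · rw [List.isChain_map]
    refine hchain.imp_of_mem_imp fun F G hF hG h => ?_
    rw [lastIndex_transport ht ht' (hface F hF), firstIndex_transport ht ht' (hface G hG), h]

theorem signVector_transport (ht : StrictMono t) (ht' : StrictMono t')
    (hσ : IsCellularString t σ) :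
    signVector t' (σ.map (transport t t')) = signVector t σ := by
  classical
  have hbreak : breakIndices t' (σ.map (transport t t')) = breakIndices t σ := by
    ext k
    simp only [breakIndices, Set.mem_ofPred_eq, List.mem_map, exists_exists_and_eq_and]
    refine exists_congr fun F => and_congr_right fun hF => ?_
    rw [firstIndex_transport ht ht' (hσ.isFace F hF), lastIndex_transport ht ht' (hσ.isFace F hF)]
  funext i
  rw [signVector_eq ht hσ.isFace, signVector_eq ht' (isCellularString_transport ht ht' hσ).isFace,
    hbreak]
  refine if_congr ?_ rfl rfl
  simp only [List.mem_map, forall_exists_index, and_imp, forall_apply_eq_imp_iff₂]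
  exact forall₂_congr fun F hF => not_congr ((isFace_transport ht ht' (hσ.isFace F hF)).2 _)

end Criterion

end CyclicString

theorem mainTheorem5 (n d : ℕ) [NeZero n] [NeZero d] (hd : 2 ≤ d) (hdn : d + 1 ≤ n) :
    (∀ t : Fin n → ℝ, StrictMono t →
      ∀ σ : List (Set (Fin d → ℝ)), CyclicString.IsCellularString t σ →
        CyclicString.cyclicPolytope d t ∉ σ →
        (CyclicString.IsCoherent t σ ↔
          CyclicString.gapNumber (CyclicString.signVector t σ) ≤ d - 2)) ∧
    (∀ t t' : Fin n → ℝ, StrictMono t → StrictMono t' →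
      ∀ σ : List (Set (Fin d → ℝ)), CyclicString.IsCellularString t σ →
        CyclicString.IsCellularString t' (σ.map (CyclicString.transport t t')) ∧
        (CyclicString.IsCoherent t σ ↔
          CyclicString.IsCoherent t' (σ.map (CyclicString.transport t t')))) := by
  have hn : 2 ≤ n := by omega
  refine ⟨fun t ht σ hσ hP => ?_, fun t t' ht ht' σ hσ => ?_⟩
  · have h0 := CyclicString.signVector_ne_zero hn ht hσ hP
    rw [CyclicString.isCoherent_iff hd hn ht hσ, CyclicString.gapNumber_le_iff _ h0,
      Nat.sub_add_cancel hd]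
    exact or_iff_right h0
  · have hσ' := CyclicString.isCellularString_transport ht ht' hσ
    refine ⟨hσ', ?_⟩
    rw [CyclicString.isCoherent_iff hd hn ht hσ, CyclicString.isCoherent_iff hd hn ht' hσ',
      CyclicString.signVector_transport ht ht' hσ]
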